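/- **Setting.** Let $B=\mathbb C[h^*_1,h^*_2,\dots]$ be the algebra of shifted symmetric functions, i.e. the polynomial ring in the complete shifted Schur functions $h^*_k$; put $h^*_0=1$ and $h^*_k=0$ for $k<0$. Let $\varphi$ be the automorphism of $B$ with $\varphi(h^*_k)=h^*_k+(k-1)h^*_{k-1}$ for $k\ge 1$, and let $h^{(r)}_k=\varphi^r h^*_{k+r}$ for $k,r\in\mathbb Z$. For an integer vector $\lambda=(\lambda_1,\dots,\lambda_l)$ put $s_\lambda=\det\big[h^{(j-1)}_{\lambda_i-i+1}\big]_{1\le i,j\le l}$ (this does not change when zeros are appended to $\lambda$); for partitions $\lambda$ these are the shifted Schur functions in Jacobi–Trudi form, and they form a linear basis of $B$. Put $e^*_r=s_{(1^r)}$ for $r\ge 0$ and $e^*_r=0$ for $r<0$. Define linear operators on $B$, for $p\in\mathbb Z$ and partitions $\lambda=(\lambda_1\ge\dots\ge\lambda_l>0)$, by $$D_p(s_\lambda)=\det\big[h^{(j)}_{\lambda_i-i}\big]_{1\le i\le l,\ j\in\{0,\dots,l\}\setminus\{p\}}\ \text{ if } 0\le p\le l,\qquad D_p(s_\lambda)=0\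 \text{ otherwise},$$ $$D^{(p)}(s_\lambda)=\sum_{t\ge1}(-1)^{t+1}h^{(p)}_{\lambda_t-t+2}\,s_{(\lambda_1+1,\dots,\lambda_{t-1}+1,\lambda_{t+1},\lambda_{t+2},\dots)},$$ where $\lambda_t=0$ for $t>l$; the sums are finite. Extend them $z$-linearly to $\mathcal B=B[z,z^{-1}]$. Define $\psi_k,\psi^*_k$ $(k\in\mathbb Z)$ on $\mathcal B$ by $$\psi_k(s_\lambda z^m)=s_{(k-m-1,\lambda)}z^{m+1},\qquad \psi^*_k(s_\lambda z^m)=\sum_{t\ge1}(-1)^{t+1}\delta_{k-m-1,\lambda_t-t}\,s_{(\lambda_1+1,\dots,\lambda_{t-1}+1,\lambda_{t+1},\lambda_{t+2},\dots)}z^{m-1}.$$ For $k\ge 0$ let $(x|k)=x(x-1)\cdots(x-k+1)$, and for $k<0$ let $(x|k)=\dfrac1{(x+1)\cdots(x-k)}$. For $m\in\mathbb Z$ put $$\Psi(u,m)=\sum_{k\in\mathbb Z}\psi_k|_{z^mB}\,u^k,\qquad \Psi^*(u,m)=\sum_{k\in\mathbb Z}\psi^*_k|_{z^mB}\,u^{-k},$$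 $$\tilde\Psi(u,m)=\sum_{k\in\mathbb Z}\psi_k|_{z^mB}\,\frac1{(u|k-1)},\qquad \tilde\Psi^*(u,m)=\sum_{k\in\mathbb Z}\psi^*_k|_{z^mB}\,(-u|k+1),$$ $$H(u)=\sum_{r\in\mathbb Z}h^*_ru^r,\quad E(u)=\sum_{r\in\mathbb Z}e^*_ru^r,\quad \tilde H(u)=\sum_{r\in\mathbb Z}\frac{h^*_r}{(u|r)},\quad \tilde E(u)=\sum_{r\in\mathbb Z}\frac{e^*_r}{(u|r)},$$ $$D\tilde E(u)=\sum_{p\in\mathbb Z}D_p\frac{(-1)^p}{(u|-p)},\qquad D\tilde H(u)=\sum_{p\in\mathbb Z}D^{(p)}\frac{(-1)^p}{(u|p)}.$$ **Proposition.** Let $m\in\mathbb Z$. Expanded in $u^{-1}$ and applied to any element of $z^mB$, all the sums in the following formulas are well-defined formal Laurent series in $u^{-1}$ with coefficients in $\mathcal B$ (each power of $u$ receives only finitely many nonzero contributions, and the occurring powers of $u$ are bounded above), and $$\Psi(1/u,m)=z\,u^{-m-1}\sum_{p\ge0}(\partial_u-1)^p\big(H(1/u)\big)\,D_p\,u^p,$$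 $$\Psi^*(1/u,m)=z^{-1}u^{m}\sum_{p\ge0}(\partial_u+1)^p\big(E(-1/u)\big)\,D^{(-p-1)}u^p,$$ $$\tilde\Psi(u,m)=z\,\frac1{(u|m)}\,\tilde H(u-m)\,D\tilde E(u-m),$$ $$\tilde\Psi^*(u,m)=z^{-1}\,(-u|m)\,\tilde E(u+m)\,D\tilde H(u+m-1).$$ Here $\partial_u$ acts only on the series in the parentheses that follow it, and $h^*_r$, $e^*_r$ act by multiplication. -/

import Mathlib

set_option maxSynthPendingDepth 3

noncomputable section

namespace ShiftedSchur

/-- The algebra `B = ℂ[h*₁, h*₂, …]` of shifted symmetric functions, as the polynomial ring in the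
complete shifted Schur functions; the variable `X n` is `h*_{n+1}`. -/
abbrev BRing : Type := MvPolynomial ℕ ℂ

/-- The complete shifted Schur functions `h*_k` for all `k ∈ ℤ`: `h*_0 = 1`, and `h*_k = 0` for
`k < 0`. -/
def hstar : ℤ → BRing
  | .ofNat 0 => 1
  | .ofNat (n + 1) => MvPolynomial.X n
  | .negSucc _ => 0

/-- Images of the generators under the inverse of the automorphism `φ` below. -/
def phiInvAux : ℕ → BRing
  | 0 => MvPolynomial.X 0
  | n + 1 => MvPolynomial.X (n + 1) - ((n + 1 : ℕ) : BRing) * phiInvAux n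

/-- The endomorphism with `h*_k ↦ h*_k + (k - 1) h*_{k-1}` for `k ≥ 1`. -/
def phiHom : BRing →ₐ[ℂ] BRing :=
  MvPolynomial.aeval fun n : ℕ => MvPolynomial.X n + (n : BRing) * hstar n

def phiInvHom : BRing →ₐ[ℂ] BRing := MvPolynomial.aeval phiInvAux

theorem phiHom_phiInvAux (n : ℕ) : phiHom (phiInvAux n) = MvPolynomial.X n := by
  induction n with
  | zero => simp [phiHom, phiInvAux]
  | succ n ih =>
    rw [phiInvAux, map_sub, map_mul, map_natCast, ih]
    simp [phiHom]
    rw [show ((n : ℤ) + 1) = Int.ofNat (n + 1) from rfl]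
    simp [hstar]

theorem phiInvHom_X_add (n : ℕ) :
    phiInvHom (MvPolynomial.X n + (n : BRing) * hstar n) = MvPolynomial.X n := by
  cases n with
  | zero => simp [phiInvHom, phiInvAux]
  | succ n =>
    rw [show ((n + 1 : ℕ) : ℤ) = Int.ofNat (n + 1) from rfl]
    simp only [hstar, map_add, map_mul, map_natCast]
    simp [phiInvHom, phiInvAux]

/-- The automorphism `φ` of `B`, see `phi_hstar`. -/
def phi : BRing ≃ₐ[ℂ] BRing :=
  AlgEquiv.ofAlgHom phiHom phiInvHom
    (by
      apply MvPolynomial.algHom_ext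
      intro n
      simpa [phiInvHom] using phiHom_phiInvAux n)
    (by
      apply MvPolynomial.algHom_ext
      intro n
      simpa [phiHom] using phiInvHom_X_add n)

theorem phi_hstar (k : ℤ) : phi (hstar k) = hstar k + ((k - 1 : ℤ) : BRing) * hstar (k - 1) := by
  match k with
  | .ofNat 0 => 
    rw [show (Int.ofNat 0 - 1 : ℤ) = Int.negSucc 0 from rfl]; simp [hstar]
  | .ofNat (n + 1) =>
    rw [show (Int.ofNat (n + 1) - 1 : ℤ) = (n : ℤ) by simp]
    simp [hstar, phi, phiHom]
  | .negSucc n =>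
    rw [show (Int.negSucc n - 1 : ℤ) = Int.negSucc (n + 1) from rfl]
    simp [hstar]

/-- `h^{(r)}_k = φ^r h*_{k+r}` for all `r, k ∈ ℤ`. -/
def hh (r k : ℤ) : BRing := (phi ^ r) (hstar (k + r))

/-- The shifted Schur function of an integer vector `v = (λ₁, …, λ_l)`, given by the Jacobi–Trudi
determinant `det [h^{(j-1)}_{λ_i-i+1}]`; the indices `i, j` below start at `0`. -/
def schur (v : List ℤ) : BRing :=
  Matrix.det (Matrix.of fun i j : Fin v.length => hh j (v[i] - i))

/-- A family that is unitriangular over a basis, for a well-founded rank, is a basis. -/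
theorem basis_of_triangular {ι α M : Type*} [LinearOrder α] [WellFoundedLT α] [AddCommGroup M]
    [Module ℂ M] (b : Module.Basis ι ℂ M) (v : ι → M) (ρ : ι → α)
    (h : ∀ i, v i - b i ∈ Submodule.span ℂ (b '' {j | ρ j < ρ i})) :
    LinearIndependent ℂ v ∧ ⊤ ≤ Submodule.span ℂ (Set.range v) := by
  have hz : ∀ i j, ρ i ≤ ρ j → b.repr (v i - b i) j = 0 := by
    intro i j hij
    have h1 := h i
    rw [Module.Basis.mem_span_image] at h1
    by_contra h0
    exact absurd (h1 (Finsupp.mem_support_iff.2 h0)) (not_lt.2 hij)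
  constructor
  · rw [linearIndependent_iff]
    intro l hl
    by_contra hne
    obtain ⟨i, hi, hmax⟩ := l.support.exists_max_image ρ (Finsupp.support_nonempty_iff.2 hne)
    have h1 : b.repr (Finsupp.linearCombination ℂ v l) i = 0 := by rw [hl]; simp
    rw [Finsupp.linearCombination_apply, Finsupp.sum, map_sum, Finset.sum_apply',
      Finset.sum_eq_single i] at h1
    · have h2 : b.repr (v i) i = 1 := by
        have := hz i i le_rfl
        rw [map_sub, Finsupp.sub_apply, sub_eq_zero] at this
        simp [this]
      rw [map_smul, Finsupp.smul_apply, h2] at h1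
      exact (Finsupp.mem_support_iff.1 hi) (by simpa using h1)
    · intro j hj hji
      have := hz j i (hmax j hj)
      rw [map_sub, Finsupp.sub_apply, sub_eq_zero] at this
      rw [map_smul, Finsupp.smul_apply, this]
      simp [hji]
    · intro h'; exact absurd hi h'
  · have key : ∀ i, b i ∈ Submodule.span ℂ (Set.range v) := by
      intro i
      induction hρ : ρ i using WellFoundedLT.induction generalizing i with
      | ind a ih =>
        subst hρ
        have h1 : Submodule.span ℂ (b '' {j | ρ j < ρ i}) ≤ Submodule.span ℂ (Set.range v) := by
          rw [Submodule.span_le]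
          rintro _ ⟨j, hj, rfl⟩
          exact ih (ρ j) hj j rfl
        have h2 := Submodule.sub_mem _ (Submodule.subset_span (Set.mem_range_self i)) (h1 (h i))
        simpa using h2
    rw [← b.span_eq, Submodule.span_le]
    rintro _ ⟨i, rfl⟩
    exact key i


/-- Weighted degree of an exponent, `h*_k` having weight `k`. -/
abbrev wt : (ℕ →₀ ℕ) →+ ℕ := Finsupp.weight fun n : ℕ => n + 1
/-- The sum of the squares of the parts of an exponent. -/
abbrev sq : (ℕ →₀ ℕ) →+ ℕ := Finsupp.weight fun n : ℕ => (n + 1) ^ 2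

theorem sq_le (d : ℕ →₀ ℕ) : sq d ≤ wt d ^ 2 := by
  induction d using Finsupp.induction_linear with
  | zero => simp
  | add f g hf hg => rw [map_add, map_add]; nlinarith [Nat.zero_le (wt f), Nat.zero_le (wt g)]
  | single n c =>
    simp only [Finsupp.weight_single, smul_eq_mul]
    rw [mul_pow]
    exact Nat.mul_le_mul_right _ (Nat.le_self_pow two_ne_zero c)

/-- Elements of weighted degree at most `n`. -/
def degLE (n : ℤ) : Submodule ℂ BRing :=
  Submodule.span ℂ (MvPolynomial.basisMonomials ℕ ℂ '' {d | (wt d : ℤ) ≤ n})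

theorem degLE_mono {m n : ℤ} (h : m ≤ n) : degLE m ≤ degLE n :=
  Submodule.span_mono (Set.image_mono fun _ hd => le_trans hd h)

theorem degLE_mul {m n : ℤ} {p q : BRing} (hp : p ∈ degLE m) (hq : q ∈ degLE n) :
    p * q ∈ degLE (m + n) := by
  have : p * q ∈ degLE m * degLE n := Submodule.mul_mem_mul hp hq
  rw [degLE, degLE, Submodule.span_mul_span] at this
  refine Submodule.span_mono ?_ this
  rintro _ ⟨_, ⟨d, hd, rfl⟩, _, ⟨e, he, rfl⟩, rfl⟩
  refine ⟨d + e, ?_, ?_⟩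
  · simp only [Set.mem_ofPred_eq, map_add] at *
    push_cast; linarith
  · simp [MvPolynomial.monomial_mul]

/-- Exponent of the monomial `h*_k`. -/
def expo (k : ℤ) : ℕ →₀ ℕ := if k ≤ 0 then 0 else Finsupp.single (k.toNat - 1) 1

theorem hstar_neg {k : ℤ} (h : k < 0) : hstar k = 0 := by
  match k with
  | .negSucc n => rfl

theorem hstar_eq {k : ℤ} (h : 0 ≤ k) : hstar k = MvPolynomial.monomial (expo k) 1 := by
  match k with
  | .ofNat 0 => simp [hstar, expo]
  | .ofNat (n + 1) =>
    have : ¬ ((n : ℤ) + 1 ≤ 0) := by omega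
    simp [hstar, expo, MvPolynomial.X, this]

theorem wt_expo {k : ℤ} (h : 0 ≤ k) : (wt (expo k) : ℤ) = k := by
  unfold expo
  split_ifs with h0
  · simp; omega
  · simp only [Finsupp.weight_single, smul_eq_mul]; omega

theorem sq_expo {k : ℤ} (h : 0 ≤ k) : (sq (expo k) : ℤ) = k ^ 2 := by
  unfold expo
  split_ifs with h0
  · have : k = 0 := by omega
    simp [this]
  · simp only [Finsupp.weight_single, smul_eq_mul]
    obtain ⟨n, rfl⟩ : ∃ n : ℕ, k = n + 1 := ⟨k.toNat - 1, by omega⟩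
    have : ((n : ℤ) + 1).toNat - 1 = n := by omega
    rw [this]; push_cast; ring

theorem hstar_mem (k : ℤ) : hstar k ∈ degLE k := by
  rcases lt_or_ge k 0 with h | h
  · rw [hstar_neg h]; exact zero_mem _
  · rw [hstar_eq h]
    exact Submodule.subset_span ⟨expo k, (wt_expo h).le, by simp⟩

theorem phi_pow_sub (r : ℕ) : ∀ k : ℤ, (phi ^ r) (hstar k) - hstar k ∈ degLE (k - 1) := by
  induction r with
  | zero => intro k; simp
  | succ r ih =>
    intro k
    rw [pow_succ, AlgEquiv.mul_apply, phi_hstar, map_add, map_mul, map_intCast]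
    have h1 := ih k
    have h2 : (phi ^ r) (hstar (k - 1)) ∈ degLE (k - 1) := by
      have := Submodule.add_mem _ (degLE_mono (by omega) (ih (k - 1))) (hstar_mem (k - 1))
      simpa using this
    have h3 : ((k - 1 : ℤ) : BRing) * (phi ^ r) (hstar (k - 1)) ∈ degLE (k - 1) := by
      rw [← zsmul_eq_mul]
      exact zsmul_mem h2 _
    have := Submodule.add_mem _ h1 h3
    convert this using 1
    ring

theorem hh_sub (r : ℕ) (k : ℤ) : hh r k - hstar (k + r) ∈ degLE (k + r - 1) := by
  have := phi_pow_sub r (k + r)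
  simpa [hh] using this

theorem prod_sub {ι : Type*} (s : Finset ι) (x y : ι → BRing) (a : ι → ℤ)
    (hy : ∀ i, y i ∈ degLE (a i)) (hxy : ∀ i, x i - y i ∈ degLE (a i - 1)) :
    ∏ i ∈ s, y i ∈ degLE (∑ i ∈ s, a i) ∧
      ∏ i ∈ s, x i - ∏ i ∈ s, y i ∈ degLE (∑ i ∈ s, a i - 1) := by
  classical
  induction s using Finset.induction_on with
  | empty =>
    simp only [Finset.prod_empty, Finset.sum_empty, sub_self, zero_mem, and_true]
    exact hstar_mem 0
  | insert i s hi ih =>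
    rw [Finset.prod_insert hi, Finset.prod_insert hi, Finset.sum_insert hi]
    refine ⟨degLE_mul (hy i) ih.1, ?_⟩
    have hx : x i ∈ degLE (a i) := by
      have := Submodule.add_mem _ (degLE_mono (by omega) (hxy i)) (hy i)
      simpa using this
    have h1 := degLE_mul hx ih.2
    have h2 := degLE_mul (hxy i) ih.1
    have h1' := degLE_mono (n := a i + ∑ i ∈ s, a i - 1) (by omega) h1
    have h2' := degLE_mono (n := a i + ∑ i ∈ s, a i - 1) (by omega) h2
    have := Submodule.add_mem _ h1' h2'
    convert this using 1
    ring

/-- Rank for which Schur functions are unitriangular over the monomials in the `h*_k`. -/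
def rank (d : ℕ →₀ ℕ) : ℕ ×ₗ ℕ := toLex (wt d, wt d ^ 2 - sq d)

theorem rank_lt {d e : ℕ →₀ ℕ} (h : wt d < wt e ∨ wt d = wt e ∧ sq e < sq d) :
    rank d < rank e := by
  rw [rank, rank, Prod.Lex.toLex_lt_toLex]
  rcases h with h | ⟨h, h'⟩
  · exact Or.inl h
  · refine Or.inr ⟨h, ?_⟩
    have := sq_le d
    simp only
    rw [h] at this ⊢
    omega

theorem prod_hstar {l : ℕ} (a : Fin l → ℤ) (h : ∀ i, 0 ≤ a i) :
    ∏ i, hstar (a i) = MvPolynomial.monomial (∑ i, expo (a i)) 1 := by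
  rw [Finset.prod_congr rfl fun i _ => hstar_eq (h i)]
  rw [MvPolynomial.monomial_sum_one]

theorem schur_sub (v : List ℤ) (hv : Antitone v.get) (h0 : ∀ i, 0 ≤ v.get i) :
    schur v - MvPolynomial.basisMonomials ℕ ℂ (∑ i, expo (v.get i)) ∈
      Submodule.span ℂ (MvPolynomial.basisMonomials ℕ ℂ ''
        {d | rank d < rank (∑ i, expo (v.get i))}) := by
  set d₀ := ∑ i, expo (v.get i) with hd₀
  set S := Submodule.span ℂ (MvPolynomial.basisMonomials ℕ ℂ '' {d | rank d < rank d₀}) with hS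
  have hw : (wt d₀ : ℤ) = ∑ i, v.get i := by
    rw [hd₀, map_sum]; push_cast
    exact Finset.sum_congr rfl fun i _ => wt_expo (h0 i)
  have hq : (sq d₀ : ℤ) = ∑ i, v.get i ^ 2 := by
    rw [hd₀, map_sum]; push_cast
    exact Finset.sum_congr rfl fun i _ => sq_expo (h0 i)
  have hlow : degLE ((wt d₀ : ℤ) - 1) ≤ S := by
    refine Submodule.span_mono (Set.image_mono fun d hd => ?_)
    refine rank_lt (Or.inl ?_)
    simp only [Set.mem_ofPred_eq] at hd
    omega
  have hterm : ∀ σ : Equiv.Perm (Fin v.length),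
      ∏ i : Fin v.length, hh ((i : ℕ) : ℤ) (v.get (σ i) - ((σ i : Fin v.length) : ℕ)) -
        ∏ i : Fin v.length, hstar (v.get (σ i) - (σ i : ℕ) + (i : ℕ)) ∈ S := by
    intro σ
    apply hlow
    have := (prod_sub Finset.univ (fun i : Fin v.length => hh ((i : ℕ) : ℤ) (v.get (σ i) - ((σ i : Fin v.length) : ℕ)))
      (fun i : Fin v.length => hstar (v.get (σ i) - (σ i : ℕ) + (i : ℕ)))
      (fun i : Fin v.length => v.get (σ i) - (σ i : ℕ) + (i : ℕ))
      (fun i => hstar_mem _) (fun i => hh_sub _ _)).2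
    convert this using 3
    rw [hw, Finset.sum_add_distrib, Finset.sum_sub_distrib, Equiv.sum_comp σ v.get,
      Equiv.sum_comp σ (fun i : Fin v.length => ((i : ℕ) : ℤ))]
    ring
  have hne : ∀ σ : Equiv.Perm (Fin v.length), σ ≠ 1 →
      ∏ i : Fin v.length, hstar (v.get (σ i) - (σ i : ℕ) + (i : ℕ)) ∈ S := by
    intro σ hσ
    by_cases hneg : ∀ i : Fin v.length, 0 ≤ v.get (σ i) - (σ i : ℕ) + (i : ℕ)
    · rw [prod_hstar _ hneg]
      refine Submodule.subset_span ⟨∑ i : Fin v.length, expo (v.get (σ i) - (σ i : ℕ) + (i : ℕ)),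
        ?_, MvPolynomial.coe_basisMonomials ℕ ℂ ▸ rfl⟩
      refine rank_lt (Or.inr ⟨Int.ofNat_inj.1 ?_, Int.ofNat_lt.1 ?_⟩)
      · rw [hw, map_sum, Nat.cast_sum]
        rw [Finset.sum_congr rfl fun i _ => wt_expo (hneg i),
          Finset.sum_add_distrib, Finset.sum_sub_distrib, Equiv.sum_comp σ v.get,
          Equiv.sum_comp σ (fun i : Fin v.length => ((i : ℕ) : ℤ))]
        ring
      · rw [hq, map_sum, Nat.cast_sum]
        rw [Finset.sum_congr rfl fun i _ => sq_expo (hneg i)]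
        have hre : ∑ i : Fin v.length, ((i : ℕ) : ℤ) * v.get i ≤
            ∑ i : Fin v.length, ((i : ℕ) : ℤ) * v.get (σ i) := by
          have hav : Antivary (fun i : Fin v.length => ((i : ℕ) : ℤ)) v.get := by
            intro i j hij
            by_contra hc
            have : i ≤ j := by
              simp only [not_le] at hc
              exact_mod_cast hc.le
            exact absurd (hv this) (not_le.2 hij)
          simpa using hav.sum_smul_le_sum_smul_comp_perm (σ := σ)
        have hre2 : ∑ i : Fin v.length, ((σ i : ℕ) : ℤ) * v.get (σ i) =
            ∑ i : Fin v.length, ((i : ℕ) : ℤ) * v.get i :=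
          Equiv.sum_comp σ (fun i : Fin v.length => ((i : ℕ) : ℤ) * v.get i)
        have hre3 : ∑ i : Fin v.length, v.get (σ i) ^ 2 = ∑ i : Fin v.length, v.get i ^ 2 :=
          Equiv.sum_comp σ (fun i : Fin v.length => v.get i ^ 2)
        have hpos : 0 < ∑ i : Fin v.length, (((i : ℕ) : ℤ) - (σ i : ℕ)) ^ 2 := by
          obtain ⟨i, hi⟩ : ∃ i, σ i ≠ i := by
            by_contra hc
            push Not at hc
            exact hσ (Equiv.ext hc)
          refine Finset.sum_pos' (fun i _ => sq_nonneg _) ⟨i, Finset.mem_univ _, ?_⟩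
          refine sq_pos_of_ne_zero fun h => hi (Fin.ext ?_)
          omega
        have hexp : ∑ i : Fin v.length, (v.get (σ i) - ((σ i : ℕ) : ℤ) + ((i : ℕ) : ℤ)) ^ 2 =
            ∑ i : Fin v.length, v.get (σ i) ^ 2 +
            2 * (∑ i : Fin v.length, ((i : ℕ) : ℤ) * v.get (σ i) -
              ∑ i : Fin v.length, ((σ i : ℕ) : ℤ) * v.get (σ i)) +
            ∑ i : Fin v.length, (((i : ℕ) : ℤ) - (σ i : ℕ)) ^ 2 := by
          rw [← Finset.sum_sub_distrib, Finset.mul_sum, ← Finset.sum_add_distrib,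
            ← Finset.sum_add_distrib]
          exact Finset.sum_congr rfl fun i _ => by ring
        rw [hexp]
        linarith
    · push Not at hneg
      obtain ⟨i, hi⟩ := hneg
      rw [Finset.prod_eq_zero (Finset.mem_univ i) (hstar_neg hi)]
      exact zero_mem _
  have hone : MvPolynomial.basisMonomials ℕ ℂ d₀ =
      ∏ i : Fin v.length, hstar (v.get i - (i : ℕ) + (i : ℕ)) := by
    simp only [sub_add_cancel]
    rw [prod_hstar _ h0]
    simp [hd₀]
  rw [schur, Matrix.det_apply, ← Finset.add_sum_erase _ _ (Finset.mem_univ 1), hone]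
  have h1 := hterm 1
  have h2 : ∑ σ ∈ Finset.univ.erase (1 : Equiv.Perm (Fin v.length)),
      Equiv.Perm.sign σ • ∏ i, (Matrix.of fun i j : Fin v.length => hh j (v[i] - i)) (σ i) i
        ∈ S := by
    refine Submodule.sum_mem _ fun σ hσ => ?_
    have h3 := Submodule.add_mem _ (hterm σ) (hne σ (Finset.ne_of_mem_erase hσ))
    rw [sub_add_cancel] at h3
    rcases Int.units_eq_one_or (Equiv.Perm.sign σ) with hs | hs <;> rw [hs]
    · simpa using h3
    · simpa using neg_mem h3
  have := Submodule.add_mem _ h1 h2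
  convert this using 1
  simp

/-- The parts `λ₁ ≥ … ≥ λ_l > 0` of a partition. -/
def parts (μ : YoungDiagram) : List ℤ := μ.rowLens.map fun n : ℕ => (n : ℤ)

/-- Exponent of `h*_{λ₁} ⋯ h*_{λ_l}`. -/
def partExpo (μ : YoungDiagram) : ℕ →₀ ℕ := (μ.rowLens.map fun n : ℕ => expo n).sum

theorem partExpo_eq (μ : YoungDiagram) :
    partExpo μ = Multiset.toFinsupp ((μ.rowLens.map Nat.pred : List ℕ) : Multiset ℕ) := by
  have : ∀ w : List ℕ, (∀ x ∈ w, 0 < x) → (w.map fun n : ℕ => expo n).sum =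
      Multiset.toFinsupp ((w.map Nat.pred : List ℕ) : Multiset ℕ) := by
    intro w
    induction w with
    | nil => intro _; simp
    | cons a w ih =>
      intro h
      rw [List.map_cons, List.sum_cons, ih fun x hx => h x (List.mem_cons_of_mem _ hx),
        List.map_cons, ← Multiset.cons_coe, ← Multiset.singleton_add, map_add,
        Multiset.toFinsupp_singleton]
      have ha : 0 < a := h a List.mem_cons_self
      have : ¬ ((a : ℤ) ≤ 0) := by omega
      rw [expo, if_neg this]
      rfl
  exact this _ μ.pos_of_mem_rowLens

theorem partExpo_bijective : Function.Bijective partExpo := by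
  constructor
  · intro μ ν h
    rw [partExpo_eq, partExpo_eq] at h
    have h1 := Multiset.coe_eq_coe.1 (Multiset.toFinsupp.injective h)
    have h2 : ∀ κ : YoungDiagram, (κ.rowLens.map Nat.pred).map Nat.succ = κ.rowLens := by
      intro κ
      rw [List.map_map]
      conv_rhs => rw [← List.map_id κ.rowLens]
      refine List.map_congr_left fun x hx => ?_
      exact Nat.succ_pred_eq_of_pos (κ.pos_of_mem_rowLens x hx)
    have h3 := h1.map Nat.succ
    rw [h2, h2] at h3
    have h4 := List.Perm.eq_of_sortedGE μ.rowLens_sorted ν.rowLens_sorted h3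
    apply YoungDiagram.equivListRowLens.injective
    exact Subtype.ext h4
  · intro d
    set w : List ℕ := ((Finsupp.toMultiset d).sort (· ≥ ·)).map Nat.succ with hw
    have hs : w.SortedGE := by
      rw [List.sortedGE_iff_pairwise, hw, List.pairwise_map]
      refine List.Pairwise.imp ?_ (Multiset.pairwise_sort (Finsupp.toMultiset d) (· ≥ ·))
      intro a b hab
      exact Nat.succ_le_succ hab
    have hp : ∀ x ∈ w, 0 < x := by
      intro x hx
      rw [hw, List.mem_map] at hx
      obtain ⟨y, -, rfl⟩ := hx
      exact Nat.succ_pos y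
    refine ⟨YoungDiagram.ofRowLens w hs, ?_⟩
    rw [partExpo_eq, YoungDiagram.rowLens_ofRowLens_eq_self hp, hw, List.map_map]
    have : (Nat.pred ∘ Nat.succ) = id := by funext n; simp
    rw [this, List.map_id, Multiset.sort_eq, Finsupp.toMultiset_toFinsupp]

/-- The shifted Schur functions of partitions form a linear basis of `B`. -/
theorem schur_basis_aux :
    LinearIndependent ℂ (fun μ : YoungDiagram => schur (parts μ)) ∧
      ⊤ ≤ Submodule.span ℂ (Set.range fun μ : YoungDiagram => schur (parts μ)) := by
  refine basis_of_triangular ((MvPolynomial.basisMonomials ℕ ℂ).reindex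
    (Equiv.ofBijective _ partExpo_bijective).symm) _ (fun μ => rank (partExpo μ)) fun μ => ?_
  have hv : Antitone (parts μ).get := by
    have : (parts μ).SortedGE := by
      rw [List.sortedGE_iff_pairwise, parts, List.pairwise_map]
      refine List.Pairwise.imp ?_ μ.rowLens_sorted.pairwise
      intro a b hab
      exact_mod_cast hab
    exact this.antitone_get
  have h0 : ∀ i, 0 ≤ (parts μ).get i := by
    intro i
    obtain ⟨n, -, hn⟩ := List.mem_map.1 (List.get_mem (parts μ) i)
    exact hn ▸ Int.natCast_nonneg n
  have hsum : ∑ i, expo ((parts μ).get i) = partExpo μ := by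
    rw [partExpo, ← List.sum_ofFn]
    congr 1
    rw [show (fun i => expo ((parts μ).get i)) = expo ∘ (parts μ).get from rfl, ← List.map_ofFn,
      List.ofFn_get, parts, List.map_map]
    rfl
  have h := schur_sub (parts μ) hv h0
  rw [hsum] at h
  refine Set.mem_of_subset_of_mem (SetLike.coe_subset_coe.2 (Submodule.span_mono ?_))
    (a := schur (parts μ) - _) (by simpa using h)
  rintro _ ⟨d, hd, rfl⟩
  obtain ⟨ν, rfl⟩ := partExpo_bijective.2 d
  exact ⟨ν, hd, by simp⟩

/-- The basis `s*_λ` of `B`, with `λ` running over all partitions. -/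
def schurBasis : Module.Basis YoungDiagram ℂ BRing :=
  Module.Basis.mk schur_basis_aux.1 schur_basis_aux.2

theorem schurBasis_apply (μ : YoungDiagram) : schurBasis μ = schur (parts μ) := by
  simp [schurBasis]


/-- The elementary shifted Schur functions `e*_r = s*_{(1^r)}`, with `e*_r = 0` for `r < 0`. -/
def estar (r : ℤ) : BRing := if 0 ≤ r then schur (List.replicate r.toNat 1) else 0

/-- The vector `(λ₁+1, …, λ_{t-1}+1, λ_{t+1}, λ_{t+2}, …)`, where `λ = v` is continued by zeros;
the index `t` starts at `0` here. -/
def removeRow (v : List ℤ) (t : ℕ) : List ℤ :=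
  ((List.range t).map fun i => v.getD i 0 + 1) ++ v.drop (t + 1)

theorem hh_eq_zero {r k : ℤ} (h : k + r < 0) : hh r k = 0 := by
  rw [hh, hstar_neg h, map_zero]

theorem hh_neg (k : ℤ) : hh k (-k) = 1 := by
  rw [hh, neg_add_cancel]
  exact map_one (phi ^ k)

/-- The operator `D_p`: `D_p s_λ = det [h^{(j)}_{λ_i-i}]` with `1 ≤ i ≤ l` and `j` running over
`0, …, l` without `p`, if `0 ≤ p ≤ l`, and `D_p s_λ = 0` otherwise. -/
def Dlow (p : ℤ) : BRing →ₗ[ℂ] BRing :=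
  schurBasis.constr ℂ fun μ =>
    if h : 0 ≤ p ∧ p ≤ (parts μ).length then
      Matrix.det (Matrix.of fun i j : Fin (parts μ).length =>
        hh ((Fin.succAbove (⟨p.toNat, by omega⟩ : Fin ((parts μ).length + 1)) j : ℕ) : ℤ)
          ((parts μ)[i] - (i : ℕ) - 1))
    else 0

/-- The operator `D^{(p)}`:
`D^{(p)} s_λ = ∑_{t ≥ 1} (-1)^{t+1} h^{(p)}_{λ_t-t+2} s_{(λ₁+1, …, λ_{t-1}+1, λ_{t+1}, …)}`.
The sum is finite by `Dup_finite`. -/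
def Dup (p : ℤ) : BRing →ₗ[ℂ] BRing :=
  schurBasis.constr ℂ fun μ =>
    ∑ᶠ t : ℕ, (-1) ^ t * hh p ((parts μ).getD t 0 - t + 1) * schur (removeRow (parts μ) t)

theorem Dup_finite (p : ℤ) (v : List ℤ) :
    (Function.support fun t : ℕ =>
      (-1) ^ t * hh p (v.getD t 0 - t + 1) * schur (removeRow v t)).Finite := by
  refine (Set.finite_lt_nat (v.length + (p + 2).toNat)).subset fun t ht => ?_
  by_contra hc
  simp only [Set.mem_ofPred_eq, not_lt] at hc
  refine ht ?_
  have : v.getD t 0 = 0 := List.getD_eq_default _ _ (by omega)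
  simp only
  rw [this, hh_eq_zero (by omega)]
  simp

open LaurentPolynomial (C T)

/-- The boson space `𝓑 = B[z, z⁻¹] = ⊕_m z^m B`; the power `z^m` is `T m`. -/
abbrev FockRing : Type := LaurentPolynomial BRing

/-- The basis `s_λ z^m` of the boson space. -/
def fockBasis : Module.Basis (ℤ × YoungDiagram) ℂ FockRing :=
  ((Finsupp.basis fun _ : ℤ => schurBasis).map
    (AddMonoidAlgebra.coeffLinearEquiv ℂ).symm).reindex (Equiv.sigmaEquivProd ℤ YoungDiagram)

theorem fockBasis_apply (m : ℤ) (μ : YoungDiagram) :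
    fockBasis (m, μ) = C (schur (parts μ)) * T m := by
  rw [← LaurentPolynomial.single_eq_C_mul_T, ← schurBasis_apply]
  simp [fockBasis]

/-- The fermion `ψ_k`: `ψ_k (s_λ z^m) = s_{(k-m-1, λ)} z^{m+1}`. -/
def psi (k : ℤ) : FockRing →ₗ[ℂ] FockRing :=
  fockBasis.constr ℂ fun x => C (schur ((k - x.1 - 1) :: parts x.2)) * T (x.1 + 1)

/-- The fermion `ψ*_k`: `ψ*_k (s_λ z^m) =
∑_{t ≥ 1} (-1)^{t+1} δ_{k-m-1, λ_t-t} s_{(λ₁+1, …, λ_{t-1}+1, λ_{t+1}, …)} z^{m-1}`.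
The sum is finite by `psiStar_finite`. -/
def psiStar (k : ℤ) : FockRing →ₗ[ℂ] FockRing :=
  fockBasis.constr ℂ fun x => ∑ᶠ t : ℕ,
    if k - x.1 - 1 = (parts x.2).getD t 0 - (t + 1) then
      (-1) ^ t * C (schur (removeRow (parts x.2) t)) * T (x.1 - 1)
    else 0

theorem psiStar_finite (k m : ℤ) (v : List ℤ) :
    (Function.support fun t : ℕ => if k - m - 1 = v.getD t 0 - (t + 1) then
      (-1) ^ t * C (schur (removeRow v t)) * T (m - 1) else (0 : FockRing)).Finite := by
  refine (Set.finite_le_nat (v.length + (m - k).toNat)).subset fun t ht => ?_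
  by_contra hc
  simp only [Set.mem_ofPred_eq, not_le] at hc
  refine ht (if_neg ?_)
  have : v.getD t 0 = 0 := List.getD_eq_default _ _ (by omega)
  rw [this]
  omega

/-- The extension of an operator on `B` to `𝓑` that commutes with `z`. -/
def zExt (S : BRing →ₗ[ℂ] BRing) : FockRing →ₗ[ℂ] FockRing :=
  (AddMonoidAlgebra.coeffLinearEquiv ℂ).symm.toLinearMap ∘ₗ Finsupp.mapRange.linearMap S ∘ₗ
    (AddMonoidAlgebra.coeffLinearEquiv ℂ).toLinearMap

theorem zExt_apply (S : BRing →ₗ[ℂ] BRing) (f : BRing) (m : ℤ) :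
    zExt S (C f * T m) = C (S f) * T m := by
  rw [← LaurentPolynomial.single_eq_C_mul_T, ← LaurentPolynomial.single_eq_C_mul_T]
  simp only [zExt, LinearMap.comp_apply]
  apply (AddMonoidAlgebra.coeffLinearEquiv ℂ).injective
  change _ = Finsupp.single m (S f)
  rw [← Finsupp.mapRange_single (f := S) (hf := map_zero S)]
  rfl

/-- The field `ℂ((u⁻¹))`: the coefficient at `n` is the coefficient of `u^{-n}`. -/
abbrev Scalar : Type := LaurentSeries ℂ
/-- Formal Laurent series in `u⁻¹` with coefficients in the boson space. -/
abbrev Series : Type := LaurentSeries FockRing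

/-- The variable `u`. -/
def u : Scalar := HahnSeries.single (-1) 1

/-- Scalar series as series over the boson space. -/
def scal (x : Scalar) : Series := x.map (algebraMap ℂ FockRing)
/-- Elements of the boson space as constant series. -/
def const (F : FockRing) : Series := HahnSeries.C F

/-- A family of series can be summed: its members have only finitely many nonzero coefficients at
each power of `u`, and their powers of `u` are jointly bounded above. -/
def FormallySummable {ι : Type} (a : ι → Series) : Prop :=
  (⋃ i, (a i).support).IsPWO ∧ ∀ n : ℤ, {i | (a i).coeff n ≠ 0}.Finite

open Classical in
/-- The formal sum of a family of series, see `formalSum_coeff`. -/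
def formalSum {ι : Type} (a : ι → Series) : Series :=
  if h : FormallySummable a then (HahnSeries.SummableFamily.mk a h.1 h.2).hsum else 0

theorem formalSum_coeff {ι : Type} {a : ι → Series} (h : FormallySummable a) (n : ℤ) :
    (formalSum a).coeff n = ∑ᶠ i, (a i).coeff n := by
  rw [formalSum, dif_pos h]
  rfl

/-- The derivation `∂_u`, see `dU_single`: the coefficient of `∂_u f` at `u^{-n}` is `1 - n` times the
coefficient of `f` at `u^{1-n}`. -/
def dU : Module.End ℂ Series where
  toFun f := HahnSeries.ofSuppBddBelow (fun n : ℤ => (1 - n) • f.coeff (n - 1)) <| by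
    refine ⟨f.order, fun n hn => ?_⟩
    by_contra hc
    refine hn ?_
    simp only
    rw [HahnSeries.coeff_eq_zero_of_lt_order (by omega), smul_zero]
  map_add' f g := by
    ext1
    funext n
    exact smul_add _ _ _
  map_smul' r f := by
    ext1
    funext n
    exact smul_comm (1 - n) r (f.coeff (n - 1))

/-- `∂_u (F u^{-n}) = -n F u^{-n-1}`. -/
theorem dU_single (n : ℤ) (F : FockRing) :
    dU (HahnSeries.single n F) = HahnSeries.single (n + 1) (-n • F) := by
  ext1
  funext k
  change (1 - k) • (HahnSeries.single n F).coeff (k - 1) = _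
  by_cases h : k = n + 1
  · subst h
    simp
  · rw [HahnSeries.coeff_single_of_ne h, HahnSeries.coeff_single_of_ne (by omega), smul_zero]

/-- The shifted power `(x|k)`: `x (x-1) ⋯ (x-k+1)` for `k ≥ 0`, and `1 / ((x+1) ⋯ (x-k))` for `k < 0`. -/
def shiftedPow (x : Scalar) : ℤ → Scalar
  | .ofNat k => ∏ i ∈ Finset.range k, (x - i)
  | .negSucc k => (∏ i ∈ Finset.range (k + 1), (x + (i + 1)))⁻¹

/-- The element `z^m f` of `z^m B`. -/
def boson (m : ℤ) (f : BRing) : FockRing := C f * T m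

/-- The variable `z` of the boson space, acting on series by multiplication. -/
def z : Series := const (T 1)

/-- The inverse of `z`. -/
def zInv : Series := const (T (-1))

/-- The terms `ψ_k(F) x^k` of `Ψ(x)` applied to `F`. -/
def PsiTerm (x : Scalar) (F : FockRing) (k : ℤ) : Series := scal (x ^ k) * const (psi k F)

/-- The terms `ψ*_k(F) x^{-k}` of `Ψ*(x)` applied to `F`. -/
def PsiStarTerm (x : Scalar) (F : FockRing) (k : ℤ) : Series := scal (x ^ (-k)) * const (psiStar k F)

/-- The terms `ψ_k(F) / (x|k-1)` of `Ψ̃(x)` applied to `F`. -/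
def PsiTildeTerm (x : Scalar) (F : FockRing) (k : ℤ) : Series :=
  scal (shiftedPow x (k - 1))⁻¹ * const (psi k F)

/-- The terms `ψ*_k(F) (-x|k+1)` of `Ψ̃*(x)` applied to `F`. -/
def PsiStarTildeTerm (x : Scalar) (F : FockRing) (k : ℤ) : Series :=
  scal (shiftedPow (-x) (k + 1)) * const (psiStar k F)

/-- The terms `h*_r x^r` of `H(x)`. -/
def HTerm (x : Scalar) (r : ℤ) : Series := scal (x ^ r) * const (C (hstar r))

/-- The terms `e*_r x^r` of `E(x)`. -/
def ETerm (x : Scalar) (r : ℤ) : Series := scal (x ^ r) * const (C (estar r))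

/-- The terms `h*_r / (x|r)` of `H̃(x)`. -/
def HTildeTerm (x : Scalar) (r : ℤ) : Series := scal (shiftedPow x r)⁻¹ * const (C (hstar r))

/-- The terms `e*_r / (x|r)` of `Ẽ(x)`. -/
def ETildeTerm (x : Scalar) (r : ℤ) : Series := scal (shiftedPow x r)⁻¹ * const (C (estar r))

/-- The terms `D_p(F) (-1)^p / (x|-p)` of `DẼ(x)` applied to `F`. -/
def DETildeTerm (x : Scalar) (F : FockRing) (p : ℤ) : Series :=
  scal ((-1) ^ p / shiftedPow x (-p)) * const (zExt (Dlow p) F)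

/-- The terms `D^{(p)}(F) (-1)^p / (x|p)` of `DH̃(x)` applied to `F`. -/
def DHTildeTerm (x : Scalar) (F : FockRing) (p : ℤ) : Series :=
  scal ((-1) ^ p / shiftedPow x p) * const (zExt (Dup p) F)

/-- The series `Ψ(x)` applied to `F`; on `F ∈ z^m B` this is `Ψ(x, m)`. -/
def Psi (x : Scalar) (F : FockRing) : Series := formalSum (PsiTerm x F)
/-- The series `Ψ*(x)` applied to `F`; on `F ∈ z^m B` this is `Ψ*(x, m)`. -/
def PsiStar (x : Scalar) (F : FockRing) : Series := formalSum (PsiStarTerm x F)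
/-- The series `Ψ̃(x)` applied to `F`; on `F ∈ z^m B` this is `Ψ̃(x, m)`. -/
def PsiTilde (x : Scalar) (F : FockRing) : Series := formalSum (PsiTildeTerm x F)
/-- The series `Ψ̃*(x)` applied to `F`; on `F ∈ z^m B` this is `Ψ̃*(x, m)`. -/
def PsiStarTilde (x : Scalar) (F : FockRing) : Series := formalSum (PsiStarTildeTerm x F)
/-- `H(x) = ∑ h*_r x^r`. -/
def H (x : Scalar) : Series := formalSum (HTerm x)
/-- `E(x) = ∑ e*_r x^r`. -/
def E (x : Scalar) : Series := formalSum (ETerm x)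
/-- `H̃(x) = ∑ h*_r / (x|r)`. -/
def HTilde (x : Scalar) : Series := formalSum (HTildeTerm x)
/-- `Ẽ(x) = ∑ e*_r / (x|r)`. -/
def ETilde (x : Scalar) : Series := formalSum (ETildeTerm x)
/-- `DẼ(x) = ∑ D_p (-1)^p / (x|-p)` applied to `F`. -/
def DETilde (x : Scalar) (F : FockRing) : Series := formalSum (DETildeTerm x F)
/-- `DH̃(x) = ∑ D^{(p)} (-1)^p / (x|p)` applied to `F`. -/
def DHTilde (x : Scalar) (F : FockRing) : Series := formalSum (DHTildeTerm x F)

/-- The terms `(∂_u - 1)^p (H(1/u)) D_p(F) u^p`, `p ≥ 0`. -/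
def HDTerm (F : FockRing) (p : ℕ) : Series :=
  ((dU - 1 : Module.End ℂ Series) ^ p) (H u⁻¹) * const (zExt (Dlow p) F) * scal (u ^ p)

/-- The terms `(∂_u + 1)^p (E(-1/u)) D^{(-p-1)}(F) u^p`, `p ≥ 0`. -/
def EDTerm (F : FockRing) (p : ℕ) : Series :=
  ((dU + 1 : Module.End ℂ Series) ^ p) (E (-u⁻¹)) * const (zExt (Dup (-(p : ℤ) - 1)) F) * scal (u ^ p)

end ShiftedSchur

end

open LaurentPolynomial (C T)

namespace ShiftedSchur

/-! Each formula is an identity of coefficients on $s_\lambda z^m$ followed by the summation of one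
generating series, for which the weights are either powers of $u$ or shifted powers.

For $\psi$, expanding the Jacobi–Trudi determinant along its first row gives
$s_{(n,\lambda)}=\sum_p(-1)^p h^{(p)}_n D_p s_\lambda$ (`schur_cons`).

For $\psi^*$, put $a_t=\lambda_t-t$ with rows counted from $0$. The element $D^{(-p-1)}s_\lambda$
combines the signed row-removed Schur functions with coefficients $\varphi^{-p-1}h^*_{a_t-p}$. The
matrix $(\varphi^{-p-1}h^*_{a-p})_{a,p}$ is unitriangular with inverse
$(\varphi^{-p}((-1)^{p-b}e^*_{p-b}))_{p,b}$ (`sum_hh_mul_signedEstar`), so single row-removed terms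
are recovered from the $D^{(-p-1)}s_\lambda$ (`finsum_removeRow`). The inverse is found from
$D^{(p)}=0$ for $p\ge0$: the defining sum is then a determinant with two equal columns, and at
$\lambda=\emptyset$ this is a relation between the $h^*$ and the $e^*$ which also yields the action
of $\varphi$ on the $e^*_t$ (`phi_signedEstar`).

It remains to sum $h^{(p)}_n$ over $n$ and $\varphi^{-p}((-1)^te^*_t)$ over $t$. Both satisfy a
two-term recursion in $p$ whose coefficient is linear in the summation index. With weights $u^{-n}$
or $u^{-t}$ that linear factor becomes a derivative, which produces the powers of $\partial_u\mp1$
(`hasFormalSum_hh`, `hasFormalSum_eCoeff`). With shifted powers as weights it is absorbed up to a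
telescoping difference, and each step multiplies the sum by a scalar (`hasFormalSum_hh_shiftedPow`,
`hasFormalSum_eCoeff_shiftedPow`). On a fixed $f$ only finitely many $D_p$ and $D^{(p)}$ are
nonzero, so the outer sums are finite. -/

/-! ### Powers of $\varphi$ on the $h^*_k$ -/

theorem phi_zpow_succ_apply (r : ℤ) (x : BRing) : (phi ^ (r + 1)) x = (phi ^ r) (phi x) := by
  rw [zpow_add_one, AlgEquiv.mul_apply]

theorem phi_zpow_add_apply (r s : ℤ) (x : BRing) : (phi ^ (r + s)) x = (phi ^ r) ((phi ^ s) x) := by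
  rw [zpow_add, AlgEquiv.mul_apply]

theorem phi_zpow_succ_hstar (r k : ℤ) :
    (phi ^ (r + 1)) (hstar k) =
      (phi ^ r) (hstar k) + ((k - 1 : ℤ) : BRing) * (phi ^ r) (hstar (k - 1)) := by
  rw [phi_zpow_succ_apply, phi_hstar, map_add, map_mul, map_intCast]

theorem hh_succ (r k : ℤ) :
    hh (r + 1) k = hh r (k + 1) + ((k + r : ℤ) : BRing) * hh r k := by
  rw [hh, hh, hh, phi_zpow_succ_hstar, show k + (r + 1) - 1 = k + r by ring,
    show k + (r + 1) = k + 1 + r by ring]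

/-! ### Jacobi–Trudi determinants and removal of a row -/

/-- The Jacobi–Trudi determinant of size `N` of a sequence. -/
noncomputable def jacobiTrudi (N : ℕ) (a : ℕ → ℤ) : BRing :=
  Matrix.det (Matrix.of fun i j : Fin N => hh (j : ℕ) (a i - (i : ℕ)))

/-- A zero part adds a last row $h^{(j)}_{-N}$, which vanishes for $j<N$ and equals $1$ for $j=N$.
-/
theorem jacobiTrudi_succ {N : ℕ} {a : ℕ → ℤ} (h : a N = 0) :
    jacobiTrudi (N + 1) a = jacobiTrudi N a := by
  rw [jacobiTrudi, Matrix.det_succ_row _ (Fin.last N), Fin.sum_univ_castSucc,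
    Finset.sum_eq_zero, zero_add]
  · simp only [Fin.succAbove_last, Matrix.of_apply, Fin.val_last, h, zero_sub, hh_neg]
    rw [← two_mul, pow_mul]
    simp only [even_two, Even.neg_pow, one_pow, mul_one, one_mul]
    rfl
  · intro j _
    have : (j : ℕ) < N := j.2
    simp only [Matrix.of_apply, Fin.val_last, h, Fin.val_castSucc]
    rw [hh_eq_zero (by omega)]
    simp

theorem schur_eq_jacobiTrudi (v : List ℤ) {N : ℕ} (h : v.length ≤ N) :
    schur v = jacobiTrudi N fun i => v.getD i 0 := by
  induction N, h using Nat.le_induction with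
  | base => simp [schur, jacobiTrudi]
  | succ N hN ih => rw [ih, jacobiTrudi_succ (List.getD_eq_default _ _ hN)]

theorem removeRow_length_le (v : List ℤ) {t N : ℕ} (hv : v.length ≤ N + 1) (ht : t ≤ N) :
    (removeRow v t).length ≤ N := by
  simp [removeRow]; omega

theorem removeRow_getD (v : List ℤ) (t i : ℕ) :
    (removeRow v t).getD i 0 = if i < t then v.getD i 0 + 1 else v.getD (i + 1) 0 := by
  split_ifs with h
  · rw [removeRow, List.getD_append _ _ _ _ (by simpa using h)]
    simp [List.getD_eq_getElem?_getD, h]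
  · rw [removeRow, List.getD_append_right _ _ _ _ (by simpa using h)]
    simp only [List.getD_eq_getElem?_getD, List.length_map, List.length_range, List.getElem?_drop]
    rw [show t + 1 + (i - t) = i + 1 by omega]

/-- Expansion along the first column of a determinant bordered by the sequence `x`. -/
theorem sum_removeRow_eq_det (v : List ℤ) {N : ℕ} (hv : v.length ≤ N + 1) (x : ℕ → BRing) :
    ∑ t ∈ Finset.range (N + 1), (-1) ^ t * x t * schur (removeRow v t) =
      Matrix.det (Matrix.of fun i j : Fin (N + 1) =>
        Fin.cases (motive := fun _ => BRing) (x i)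
          (fun j : Fin N => hh (j : ℕ) (v.getD i 0 - (i : ℕ) + 1)) j) := by
  rw [Matrix.det_succ_column_zero, ← Fin.sum_univ_eq_sum_range
    (fun t => (-1) ^ t * x t * schur (removeRow v t))]
  refine Finset.sum_congr rfl fun t _ => ?_
  rw [schur_eq_jacobiTrudi _ (removeRow_length_le v hv (Nat.lt_succ_iff.1 t.2)), jacobiTrudi]
  simp only [Matrix.of_apply, Fin.cases_zero]
  congr 2
  ext1 i j
  simp only [Matrix.of_apply, Matrix.submatrix_apply, Fin.cases_succ]
  congr 1
  -- The added ones compensate the shift of row numbers: every remaining row $i'$ of the original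
  -- matrix has entries $h^{(j)}_{v_{i'}-i'+1}$, above and below the deleted row alike.
  rw [removeRow_getD]
  split_ifs with h
  · rw [Fin.succAbove_of_castSucc_lt _ _ (by exact h)]
    simp; ring
  · rw [Fin.succAbove_of_le_castSucc _ _ (by exact not_lt.1 h)]
    simp
    ring

/-- The alternating sum defining `D^{(p)} s_v`. -/
noncomputable def dupSum (p : ℤ) (v : List ℤ) : BRing :=
  ∑ᶠ t : ℕ, (-1) ^ t * hh p (v.getD t 0 - t + 1) * schur (removeRow v t)

theorem dupSum_eq_sum (p : ℤ) (v : List ℤ) {N : ℕ} (hN : v.length + (p + 2).toNat ≤ N) :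
    dupSum p v = ∑ t ∈ Finset.range N,
      (-1) ^ t * hh p (v.getD t 0 - t + 1) * schur (removeRow v t) := by
  refine finsum_eq_sum_of_support_subset _ fun t ht => ?_
  by_contra hc
  simp only [Finset.coe_range, Set.mem_Iio, not_lt] at hc
  refine ht ?_
  have : v.getD t 0 = 0 := List.getD_eq_default _ _ (by omega)
  simp only
  rw [this, hh_eq_zero (by omega)]
  simp

/-- For $p\ge0$ the bordering column $h^{(p)}_{v_i-i+1}$ already occurs in the bordered determinant
once its size exceeds $p+1$. -/
theorem dupSum_eq_zero {p : ℤ} (hp : 0 ≤ p) (v : List ℤ) : dupSum p v = 0 := by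
  set N := v.length + (p + 2).toNat with hN
  rw [dupSum_eq_sum p v (N := N + 1) (by omega),
    sum_removeRow_eq_det v (by omega) (fun t => hh p (v.getD t 0 - t + 1))]
  have hlt : p.toNat < N := by omega
  refine Matrix.det_zero_of_column_eq (i := 0) (j := Fin.succ ⟨p.toNat, hlt⟩)
    (Fin.succ_ne_zero _).symm fun i => ?_
  simp [Int.toNat_of_nonneg hp]

/-! ### Relations between $h^*$ and $e^*$, and the inverse matrix -/

/-- The signed elementary shifted Schur functions `(-1)^t e*_t`. -/
noncomputable def signedEstar (t : ℤ) : BRing := (-1 : ℂ) ^ t • estar t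

theorem estar_neg {t : ℤ} (h : t < 0) : estar t = 0 := if_neg (not_le.2 h)

theorem signedEstar_neg {t : ℤ} (h : t < 0) : signedEstar t = 0 := by
  rw [signedEstar, estar_neg h, smul_zero]

theorem signedEstar_zero : signedEstar 0 = 1 := by
  simp [signedEstar, estar, schur]

theorem signedEstar_natCast (t : ℕ) : signedEstar t = (-1) ^ t * schur (removeRow [] t) := by
  have : removeRow [] t = List.replicate t 1 := by
    simp only [removeRow, List.getD_nil, List.drop_nil, List.append_nil, zero_add]
    exact List.map_const' .. |>.trans (by simp)
  rw [signedEstar, estar, if_pos (Int.natCast_nonneg t), this, Int.toNat_natCast, zpow_natCast,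
    Algebra.smul_def]
  simp

/-- For $n\ge1$ this is the vanishing of $D^{(n-1)}$ on $s_\emptyset$, whose row-removed functions
are the $e^*_t$. It replaces the classical $\sum(-1)^te_th_{n-t}=0$. -/
theorem sum_hstar_mul_signedEstar (n : ℕ) :
    ∑ t ∈ Finset.range (n + 1), (phi ^ ((n : ℤ) - 1)) (hstar (n - t)) * signedEstar t =
      if n = 0 then 1 else 0 := by
  rcases Nat.eq_zero_or_pos n with rfl | hn
  · simp [signedEstar_zero, hstar_eq le_rfl, expo]
  · rw [if_neg hn.ne', ← dupSum_eq_zero (p := n - 1) (by omega) [],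
      dupSum_eq_sum (n - 1) [] (N := n + 1) (by simp only [List.length_nil]; omega)]
    refine Finset.sum_congr rfl fun t _ => ?_
    rw [signedEstar_natCast, hh, List.getD_nil,
      show (0 - (t : ℤ) + 1 + ((n : ℤ) - 1)) = n - t by ring]
    ring

/-- The coefficient of $g_n$ in the $n$-th relation is $\varphi^{n-1}(h^*_0)=1$, so the relations
determine $g$ recursively. -/
theorem eq_signedEstar {g : ℕ → BRing}
    (hg : ∀ n : ℕ, ∑ t ∈ Finset.range (n + 1), (phi ^ ((n : ℤ) - 1)) (hstar (n - t)) * g t =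
      if n = 0 then 1 else 0) (n : ℕ) : g n = signedEstar n := by
  induction n using Nat.strong_induction_on with
  | _ n ih =>
    have h := (hg n).trans (sum_hstar_mul_signedEstar n).symm
    rw [Finset.sum_range_succ, Finset.sum_range_succ,
      Finset.sum_congr rfl fun t ht => by rw [ih t (Finset.mem_range.1 ht)], add_right_inj] at h
    simpa [hstar_eq le_rfl, expo] using h

/-- The dual of the rule $\varphi(h^*_k)=h^*_k+(k-1)h^*_{k-1}$. By uniqueness it suffices that the
left side satisfies the relations characterising the signed $e^*_t$. -/
theorem phi_signedEstar (t : ℤ) :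
    phi (signedEstar t - ((t - 1 : ℤ) : BRing) * signedEstar (t - 1)) = signedEstar t := by
  rcases lt_or_ge t 0 with h | h
  · rw [signedEstar_neg h, signedEstar_neg (by omega)]; simp
  obtain ⟨k, rfl⟩ := Int.eq_ofNat_of_zero_le h
  refine eq_signedEstar (g := fun k : ℕ =>
    phi (signedEstar k - ((k - 1 : ℤ) : BRing) * signedEstar (k - 1))) (fun n => ?_) k
  have h0 : hstar (n - (n + 1 : ℕ)) = 0 := hstar_neg (by omega)
  -- Shifting the index in the part with $e^*_{t-1}$ collects everything under $\varphi(\pm e^*_t)$;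
  -- both boundary terms vanish.
  have e1 : ∑ t ∈ Finset.range (n + 1), (phi ^ ((n : ℤ) - 1)) (hstar (n - t)) *
      phi (signedEstar t - ((t - 1 : ℤ) : BRing) * signedEstar (t - 1)) =
      ∑ t ∈ Finset.range (n + 1), (phi ^ ((n : ℤ) - 1)) (hstar (n - t)) * phi (signedEstar t) -
      ∑ t ∈ Finset.range (n + 1), (phi ^ ((n : ℤ) - 1)) (hstar (n - (t + 1 : ℕ))) *
        ((t : BRing) * phi (signedEstar t)) := by
    rw [Finset.sum_range_succ (fun t => (phi ^ ((n : ℤ) - 1)) (hstar (n - (t + 1 : ℕ))) *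
        ((t : BRing) * phi (signedEstar t))), h0]
    simp only [map_sub, map_mul, mul_sub, Finset.sum_sub_distrib, map_zero, zero_mul, add_zero,
      map_intCast]
    rw [Finset.sum_range_succ' (fun t => (phi ^ ((n : ℤ) - 1)) (hstar (n - t)) *
      (((t - 1 : ℤ) : BRing) * phi (signedEstar (t - 1))))]
    simp [signedEstar_neg]
  -- $\varphi$ applied to the $n$-th relation minus $n-1$ times the preceding one. The preceding one
  -- is not zero at $n=1$, but its factor $n-1$ is.
  have e2 : ∑ t ∈ Finset.range (n + 1), phi ((phi ^ ((n : ℤ) - 1)) (hstar (n - t)) * signedEstar t) -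
      ((n - 1 : ℤ) : BRing) * ∑ t ∈ Finset.range (n + 1),
        phi ((phi ^ ((n : ℤ) - 2)) (hstar (n - 1 - t)) * signedEstar t) =
      if n = 0 then 1 else 0 := by
    rw [← map_sum, ← map_sum, sum_hstar_mul_signedEstar]
    rcases n with _ | _ | n
    · simp [hstar_neg]
    · simp
    · have := sum_hstar_mul_signedEstar (n + 1)
      rw [Finset.sum_range_succ]
      push_cast at this ⊢
      rw [show ((n : ℤ) + 1 + 1 - 2) = n + 1 - 1 by ring, show ((n : ℤ) + 1 + 1 - 1) = n + 1 by ring,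
        this, hstar_neg (by omega)]
      simp
  rw [e1, ← e2, Finset.mul_sum, ← Finset.sum_sub_distrib, ← Finset.sum_sub_distrib]
  refine Finset.sum_congr rfl fun t _ => ?_
  have c : ∀ r x, phi ((phi ^ (r - 1)) x) = (phi ^ (r : ℤ)) x := fun r x => by
    conv_rhs => rw [show r = 1 + (r - 1) by ring, phi_zpow_add_apply, zpow_one]
  -- The two sums now agree termwise: the coefficient $n-t-1$ arising here, minus $n-1$, is the
  -- required $-t$.
  have e3 := phi_zpow_succ_hstar ((n : ℤ) - 1) (n - t)
  rw [map_mul, map_mul, c, show (n : ℤ) - 2 = (n - 1) - 1 by ring, c]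
  rw [sub_add_cancel] at e3
  rw [e3]
  push_cast
  rw [show (n : ℤ) - (t + 1) = n - t - 1 by ring, show (n : ℤ) - 1 - t = n - t - 1 by ring]
  ring

theorem phi_neg_succ_signedEstar (r t : ℤ) :
    (phi ^ (-(r + 1))) (signedEstar t) = (phi ^ (-r)) (signedEstar t) -
      ((t - 1 : ℤ) : BRing) * (phi ^ (-r)) (signedEstar (t - 1)) := by
  conv_lhs => rw [← phi_signedEstar, ← phi_zpow_succ_apply]
  rw [show -(r + 1) + 1 = -r by ring, map_sub, map_mul, map_intCast]

/-- Obtained by applying $\varphi^{-p}$ to the relation for $n=p-k$. The set $S$ may be any superset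
of the range where both factors can be nonzero. -/
theorem sum_signedEstar_mul_hstar {p k : ℤ} {S : Finset ℤ} (hS : Finset.Icc k p ⊆ S) :
    ∑ i ∈ S, (phi ^ (-p)) (signedEstar (p - i)) * (phi ^ (-k - 1)) (hstar (i - k)) =
      if p = k then 1 else 0 := by
  rw [← Finset.sum_subset hS]
  · rcases lt_or_ge p k with h | h
    · rw [Finset.Icc_eq_empty (not_le.2 h), Finset.sum_empty, if_neg h.ne]
    obtain ⟨n, rfl⟩ : ∃ n : ℕ, p = k + n := ⟨(p - k).toNat, by omega⟩
    have := congrArg (phi ^ (-(k + n : ℤ))) (sum_hstar_mul_signedEstar n)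
    rw [map_sum] at this
    calc _ = _ := ?_
      _ = _ := this
      _ = _ := by rcases n with _ | n <;> simp; omega
    symm
    refine Finset.sum_nbij' (fun t : ℕ => k + n - t) (fun i : ℤ => (k + n - i).toNat) ?_ ?_ ?_ ?_ ?_
    · intro t ht
      rw [Finset.mem_range] at ht
      rw [Finset.mem_Icc]; omega
    · intro i hi
      rw [Finset.mem_Icc] at hi
      rw [Finset.mem_range]; omega
    · intro t _; simp
    · intro i hi
      rw [Finset.mem_Icc] at hi
      omega
    · intro t _
      rw [map_mul, ← phi_zpow_add_apply, mul_comm]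
      congr 3
      · ring
      · ring
      · ring
  · intro i _ hi
    rw [Finset.mem_Icc] at hi
    rcases lt_or_ge i k with h | h
    · rw [hstar_neg (by omega), map_zero, mul_zero]
    · rw [signedEstar_neg (by omega), map_zero, zero_mul]

/-- The product of the same two matrices in the other order. Here the power of $\varphi$ varies with
the summation index, so this is not the image of a single relation; it follows because one-sided
inverses of finite square matrices over a commutative ring are two-sided. -/
theorem sum_hh_mul_signedEstar {a b : ℤ} {S : Finset ℤ} (hS : Finset.Icc b a ⊆ S) :
    ∑ p ∈ S, hh (-p - 1) (a + 1) * (phi ^ (-p)) (signedEstar (p - b)) =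
      if a = b then 1 else 0 := by
  have hh' : ∀ p, hh (-p - 1) (a + 1) = (phi ^ (-p - 1)) (hstar (a - p)) := fun p => by
    rw [hh]; congr 2; ring
  simp only [hh']
  rw [← Finset.sum_subset hS]
  · rcases lt_or_ge a b with h | h
    · rw [Finset.Icc_eq_empty (not_le.2 h), Finset.sum_empty, if_neg h.ne]
    -- Triangularity confines all nonzero terms to the window from $b$ to $a$, so finite blocks
    -- suffice.
    let A : Matrix (Finset.Icc b a) (Finset.Icc b a) BRing :=
      Matrix.of fun i p => (phi ^ (-(p : ℤ) - 1)) (hstar (i - p))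
    let K : Matrix (Finset.Icc b a) (Finset.Icc b a) BRing :=
      Matrix.of fun p i => (phi ^ (-(p : ℤ))) (signedEstar (p - i))
    have hKA : K * A = 1 := by
      ext1 p k
      have hsub : Finset.Icc (k : ℤ) p ⊆ Finset.Icc b a :=
        Finset.Icc_subset_Icc (Finset.mem_Icc.1 k.2).1 (Finset.mem_Icc.1 p.2).2
      rw [Matrix.mul_apply, Matrix.one_apply]
      simp only [A, K, Matrix.of_apply, ← Subtype.coe_inj]
      rw [← sum_signedEstar_mul_hstar hsub]
      exact Finset.sum_coe_sort (Finset.Icc b a) fun i =>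
        (phi ^ (-(p : ℤ))) (signedEstar (p - i)) * (phi ^ (-(k : ℤ) - 1)) (hstar (i - k))
    have hAK' : A * K = 1 := mul_eq_one_comm.1 hKA
    have hAK := congrFun (congrFun hAK'
      ⟨a, Finset.mem_Icc.2 ⟨h, le_rfl⟩⟩) ⟨b, Finset.mem_Icc.2 ⟨le_rfl, h⟩⟩
    rw [Matrix.mul_apply, Matrix.one_apply] at hAK
    simp only [A, K, Matrix.of_apply, Subtype.mk.injEq] at hAK
    rw [← hAK]
    exact (Finset.sum_coe_sort (Finset.Icc b a) fun p =>
      (phi ^ (-p - 1)) (hstar (a - p)) * (phi ^ (-p)) (signedEstar (p - b))).symm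
  · intro p _ hp
    rw [Finset.mem_Icc] at hp
    rcases lt_or_ge p b with h | h
    · rw [signedEstar_neg (by omega), map_zero, mul_zero]
    · rw [hstar_neg (by omega), map_zero, zero_mul]

/-! ### Fermions on Schur functions through $D_p$ and $D^{(p)}$ -/

/-- The coefficients of the vertex operator of `ψ*` in terms of the operators `D^{(-p-1)}`. -/
theorem finsum_removeRow (v : List ℤ) (b : ℤ) {P : ℕ} (hP : ∀ t : ℕ, v.getD t 0 - t < P) :
    (∑ᶠ t : ℕ, if v.getD t 0 - t = b then (-1) ^ t * schur (removeRow v t) else 0) =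
      ∑ p ∈ Finset.range P, (phi ^ (-(p : ℤ))) (signedEstar (p - b)) * dupSum (-p - 1) v := by
  -- The inversion needs all $p$ from $b$ upwards, and $b$ may be negative. Since $D^{(-p-1)}=0$ for
  -- $p<0$, the range can be extended down to $c$; the bound $N$ then truncates the row sums for all
  -- these $p$ at once.
  set c := min b 0 with hc
  set N := v.length + (1 - c).toNat with hN
  have h1 : (∑ᶠ t : ℕ, if v.getD t 0 - t = b then (-1) ^ t * schur (removeRow v t) else 0) =
      ∑ t ∈ Finset.range N,
        if v.getD t 0 - t = b then (-1) ^ t * schur (removeRow v t) else 0 := by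
    refine finsum_eq_sum_of_support_subset _ fun t ht => ?_
    by_contra hcon
    simp only [Finset.coe_range, Set.mem_Iio, not_lt] at hcon
    refine ht (if_neg ?_)
    rw [List.getD_eq_default _ _ (by omega)]
    omega
  have h2 : ∑ p ∈ Finset.range P, (phi ^ (-(p : ℤ))) (signedEstar (p - b)) * dupSum (-p - 1) v =
      ∑ p ∈ Finset.Ico c P, (phi ^ (-p)) (signedEstar (p - b)) * dupSum (-p - 1) v := by
    rw [← Finset.sum_image (s := Finset.range P) (g := fun p : ℕ => (p : ℤ))
      (f := fun p : ℤ => (phi ^ (-p)) (signedEstar (p - b)) * dupSum (-p - 1) v)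
      (fun x _ y _ h => Int.ofNat_inj.1 h)]
    refine Finset.sum_subset ?_ ?_
    · intro p hp
      obtain ⟨q, hq, rfl⟩ := Finset.mem_image.1 hp
      rw [Finset.mem_range] at hq
      rw [Finset.mem_Ico]; omega
    · intro p hp hp'
      rw [Finset.mem_Ico] at hp
      rcases lt_or_ge p 0 with h | h
      · rw [dupSum_eq_zero (by omega), mul_zero]
      · refine absurd (Finset.mem_image.2 ⟨p.toNat, ?_, ?_⟩) hp'
        · rw [Finset.mem_range]; omega
        · omega
  rw [h1, h2]
  have h3 : ∀ p ∈ Finset.Ico c (P : ℤ), (phi ^ (-p)) (signedEstar (p - b)) * dupSum (-p - 1) v =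
      ∑ t ∈ Finset.range N, ((-1) ^ t * schur (removeRow v t)) *
        (hh (-p - 1) (v.getD t 0 - t + 1) * (phi ^ (-p)) (signedEstar (p - b))) := by
    intro p hp
    rw [Finset.mem_Ico] at hp
    rw [dupSum_eq_sum _ _ (N := N) (by omega), Finset.mul_sum]
    exact Finset.sum_congr rfl fun t _ => by ring
  rw [Finset.sum_congr rfl h3, Finset.sum_comm]
  refine Finset.sum_congr rfl fun t _ => ?_
  rw [← Finset.mul_sum, sum_hh_mul_signedEstar]
  · split_ifs <;> simp
  · intro p hp
    have := hP t
    rw [Finset.mem_Icc] at hp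
    rw [Finset.mem_Ico]; omega

/-- Expansion of `s_{(n, v)}` along the first row. -/
theorem schur_cons (n : ℤ) (v : List ℤ) :
    schur (n :: v) = ∑ p : Fin (v.length + 1), (-1) ^ (p : ℕ) * hh (p : ℕ) n *
      Matrix.det (Matrix.of fun i j : Fin v.length =>
        hh ((p.succAbove j : ℕ) : ℤ) (v[i] - (i : ℕ) - 1)) := by
  refine (Matrix.det_succ_row_zero _).trans (Finset.sum_congr rfl fun p _ => ?_)
  congr 1
  · simp
  · congr 1
    ext1 i j
    simp
    congr 1
    ring

/-! ### Order filtration and convergence of formal sums -/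

/-- The series `x` has no term `u^{-j}` with `j < n`. -/
def OrdGE {R : Type*} [Zero R] (x : LaurentSeries R) (n : ℤ) : Prop := ∀ j < n, x.coeff j = 0

namespace OrdGE
variable {R : Type*}

theorem mono [Zero R] {x : LaurentSeries R} {m n : ℤ} (h : OrdGE x n) (hmn : m ≤ n) : OrdGE x m :=
  fun j hj => h j (hj.trans_le hmn)

theorem zero [Zero R] (n : ℤ) : OrdGE (0 : LaurentSeries R) n := fun _ _ => rfl

theorem add [AddCommGroup R] {x y : LaurentSeries R} {n : ℤ} (hx : OrdGE x n) (hy : OrdGE y n) :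
    OrdGE (x + y) n := fun j hj => by rw [HahnSeries.coeff_add, hx j hj, hy j hj, add_zero]

theorem sub [AddCommGroup R] {x y : LaurentSeries R} {n : ℤ} (hx : OrdGE x n) (hy : OrdGE y n) :
    OrdGE (x - y) n := fun j hj => by rw [HahnSeries.coeff_sub, hx j hj, hy j hj, sub_zero]

theorem mul [CommRing R] {x y : LaurentSeries R} {m n : ℤ} (hx : OrdGE x m) (hy : OrdGE y n) :
    OrdGE (x * y) (m + n) := fun j hj => by
  rw [HahnSeries.coeff_mul]
  refine Finset.sum_eq_zero fun ij hij => ?_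
  have := (Finset.mem_antidiagonal.1 hij).2.2
  rcases lt_or_ge ij.1 m with h | h
  · rw [hx _ h, zero_mul]
  · rw [hy _ (by omega), mul_zero]

theorem order [Zero R] (x : LaurentSeries R) : OrdGE x x.order :=
  fun _ hj => HahnSeries.coeff_eq_zero_of_lt_order hj

theorem single [Zero R] (n : ℤ) (r : R) : OrdGE (HahnSeries.single n r) n :=
  fun _ hj => HahnSeries.coeff_single_of_ne hj.ne

theorem const (F : FockRing) : OrdGE (const F) 0 := single 0 F

theorem scal {x : Scalar} {n : ℤ} (h : OrdGE x n) : OrdGE (scal x) n :=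
  fun j hj => by simp [ShiftedSchur.scal, h j hj]

theorem dU {x : Series} {n : ℤ} (h : OrdGE x n) : OrdGE (ShiftedSchur.dU x) n := fun j hj => by
  change (1 - j) • x.coeff (j - 1) = 0
  rw [h _ (by omega), smul_zero]

theorem eq_zero [Zero R] {x : LaurentSeries R} (h : ∀ n, OrdGE x n) : x = 0 := by
  ext1
  funext j
  exact h (j + 1) j (by omega)

end OrdGE

theorem scal_coeff (x : Scalar) (n : ℤ) : (scal x).coeff n = algebraMap ℂ FockRing (x.coeff n) := rfl

theorem scal_support (x : Scalar) : (scal x).support = x.support := by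
  ext n
  rw [HahnSeries.mem_support, HahnSeries.mem_support, scal_coeff, Ne,
    map_eq_zero_iff _ (algebraMap ℂ FockRing).injective]

theorem scal_mul (x y : Scalar) : scal (x * y) = scal x * scal y := by
  ext1
  funext n
  rw [scal_coeff, HahnSeries.coeff_mul, HahnSeries.coeff_mul, map_sum]
  refine Finset.sum_congr ?_ fun ij _ => by rw [map_mul, scal_coeff, scal_coeff]
  ext ij
  simp only [Finset.mem_antidiagonal, scal_support]

theorem scal_add (x y : Scalar) : scal (x + y) = scal x + scal y := by
  ext1
  funext n
  simp [scal_coeff]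

theorem scal_single (n : ℤ) (c : ℂ) :
    scal (HahnSeries.single n c) = HahnSeries.single n (algebraMap ℂ FockRing c) := by
  ext1
  funext k
  rw [scal_coeff, HahnSeries.coeff_single, HahnSeries.coeff_single]
  split_ifs <;> simp

theorem scal_one : scal 1 = 1 := by
  change scal (HahnSeries.single 0 1) = HahnSeries.single 0 1
  rw [scal_single, (algebraMap ℂ FockRing).map_one]

/-- `scal` as a ring homomorphism. -/
noncomputable def scalHom : Scalar →+* Series where
  toFun := scal
  map_one' := scal_one
  map_mul' := scal_mul
  map_zero' := by ext1; funext n; simp [scal_coeff]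
  map_add' := scal_add

theorem scal_intCast (n : ℤ) : scal n = n := map_intCast scalHom n
theorem scal_neg (x : Scalar) : scal (-x) = -scal x := map_neg scalHom x
theorem scal_sub (x y : Scalar) : scal (x - y) = scal x - scal y := map_sub scalHom x y

theorem u_zpow (k : ℤ) : u ^ k = HahnSeries.single (-k) 1 := by
  have hu : u ≠ 0 := HahnSeries.single_ne_zero one_ne_zero
  have h1 : u⁻¹ = HahnSeries.single 1 1 := by
    rw [inv_eq_iff_eq_inv, eq_comm]
    refine inv_eq_of_mul_eq_one_right ?_
    rw [u, HahnSeries.single_mul_single]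
    simp
  induction k using Int.induction_on with
  | zero => simp
  | succ k ih =>
    rw [zpow_add_one₀ hu, ih, u, HahnSeries.single_mul_single, mul_one]; congr 2; ring
  | pred k ih =>
    rw [zpow_sub_one₀ hu, ih, h1, HahnSeries.single_mul_single, mul_one]; congr 2; ring

theorem u_ne_zero : u ≠ 0 := HahnSeries.single_ne_zero one_ne_zero

theorem scal_u_zpow (k : ℤ) : scal (u ^ k) = HahnSeries.single (-k) 1 := by
  rw [u_zpow, scal_single, map_one]

/-- Convergence of a formal sum in the topology of decreasing powers of `u`. -/
def HasFormalSum {ι : Type} (a : ι → Series) (S : Series) : Prop :=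
  ∀ n, ∃ s : Finset ι, ∀ t, s ⊆ t → OrdGE (S - ∑ i ∈ t, a i) n

/-- If all but finitely many terms have order at least $n$, for every $n$, the supports are jointly
bounded below and each coefficient is a finite sum. -/
theorem exists_hasFormalSum {ι : Type} {a : ι → Series}
    (h : ∀ n, {i | ¬ OrdGE (a i) n}.Finite) : FormallySummable a ∧ HasFormalSum a (formalSum a) := by
  have hs : FormallySummable a := by
    constructor
    · have hb : BddBelow (⋃ i, (a i).support) := by
        have : (⋃ i, (a i).support) ⊆ Set.Ici 0 ∪ ⋃ i ∈ {i | ¬ OrdGE (a i) 0}, (a i).support := by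
          intro n hn
          obtain ⟨i, hi⟩ := Set.mem_iUnion.1 hn
          by_cases h0 : OrdGE (a i) 0
          · left
            by_contra hc
            exact hi (h0 n (not_le.1 hc))
          · exact Or.inr (Set.mem_biUnion h0 hi)
        refine BddBelow.mono this (bddBelow_Ici.union ?_)
        rw [(h 0).bddBelow_biUnion]
        intro i _
        refine ⟨(a i).order, fun n hn => ?_⟩
        by_contra hc
        exact hn (OrdGE.order (a i) n (not_le.1 hc))
      exact hb.isWF.isPWO
    · intro n
      refine (h (n + 1)).subset fun i hi hc => hi (hc n (by omega))
  refine ⟨hs, fun n => ⟨(h n).toFinset, fun t ht j hj => ?_⟩⟩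
  rw [HahnSeries.coeff_sub, formalSum_coeff hs, HahnSeries.coeff_sum, sub_eq_zero]
  refine finsum_eq_sum_of_support_subset _ fun i hi => ht ?_
  rw [Set.Finite.mem_toFinset]
  exact fun hc => hi (hc j hj)

namespace HasFormalSum
variable {ι κ : Type} {a b : ι → Series} {S S' : Series}

theorem unique (h : HasFormalSum a S) (h' : HasFormalSum a S') : S = S' := by
  classical
  rw [← sub_eq_zero]
  refine OrdGE.eq_zero fun n => ?_
  obtain ⟨s, hs⟩ := h n
  obtain ⟨s', hs'⟩ := h' n
  have := (hs (s ∪ s') Finset.subset_union_left).sub (hs' (s ∪ s') Finset.subset_union_right)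
  simpa using this

/-- A term outside the finite set $s$ is the difference of two partial sums that both agree with $S$
below order $n$. Convergence therefore already implies summability. -/
theorem finite (h : HasFormalSum a S) (n : ℤ) : {i | ¬ OrdGE (a i) n}.Finite := by
  classical
  obtain ⟨s, hs⟩ := h n
  refine s.finite_toSet.subset fun i hi => ?_
  by_contra hc
  refine hi ?_
  have := (hs s subset_rfl).sub (hs (insert i s) (Finset.subset_insert i s))
  rw [Finset.sum_insert hc] at this
  simpa using this

theorem formallySummable (h : HasFormalSum a S) : FormallySummable a :=
  (exists_hasFormalSum h.finite).1

theorem formalSum_eq (h : HasFormalSum a S) : formalSum a = S :=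
  (exists_hasFormalSum h.finite).2.unique h

theorem add (h : HasFormalSum a S) (h' : HasFormalSum b S') :
    HasFormalSum (fun i => a i + b i) (S + S') := fun n => by
  classical
  obtain ⟨s, hs⟩ := h n
  obtain ⟨s', hs'⟩ := h' n
  refine ⟨s ∪ s', fun t ht => ?_⟩
  have := (hs t (Finset.union_subset_left ht)).add (hs' t (Finset.union_subset_right ht))
  rwa [Finset.sum_add_distrib, add_sub_add_comm]

theorem mul_right (h : HasFormalSum a S) (x : Series) :
    HasFormalSum (fun i => a i * x) (S * x) := fun n => by
  obtain ⟨s, hs⟩ := h (n - x.order)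
  refine ⟨s, fun t ht => ?_⟩
  have := (hs t ht).mul (OrdGE.order x)
  rwa [sub_add_cancel, sub_mul, Finset.sum_mul] at this

theorem mul_left (h : HasFormalSum a S) (x : Series) :
    HasFormalSum (fun i => x * a i) (x * S) := by
  simpa only [mul_comm x] using h.mul_right x

theorem sub (h : HasFormalSum a S) (h' : HasFormalSum b S') :
    HasFormalSum (fun i => a i - b i) (S - S') := by
  simpa only [sub_eq_add_neg, neg_one_mul] using h.add (h'.mul_left (-1))

theorem dU (h : HasFormalSum a S) : HasFormalSum (fun i => dU (a i)) (dU S) := fun n => by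
  obtain ⟨s, hs⟩ := h n
  refine ⟨s, fun t ht => ?_⟩
  have := (hs t ht).dU
  rwa [map_sub, map_sum] at this

theorem comp_equiv (h : HasFormalSum a S) (e : κ ≃ ι) : HasFormalSum (fun k => a (e k)) S :=
  fun n => by
  obtain ⟨s, hs⟩ := h n
  refine ⟨s.map e.symm.toEmbedding, fun t ht => ?_⟩
  have := hs (t.map e.toEmbedding) fun i hi => by
    have := ht (Finset.mem_map_of_mem e.symm.toEmbedding hi)
    simpa using Finset.mem_map_of_mem e.toEmbedding this
  simpa using this

theorem of_forall_notMem_eq_zero (s : Finset ι) (h : ∀ i ∉ s, a i = 0) :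
    HasFormalSum a (∑ i ∈ s, a i) := fun n => ⟨s, fun t ht => by
  rw [Finset.sum_subset ht fun i _ hi => h i hi, sub_self]
  exact OrdGE.zero n⟩

theorem sum {f : κ → ι → Series} {σ : κ → Series} (s : Finset κ)
    (h : ∀ k ∈ s, HasFormalSum (f k) (σ k)) :
    HasFormalSum (fun i => ∑ k ∈ s, f k i) (∑ k ∈ s, σ k) := by
  classical
  induction s using Finset.induction_on with
  | empty => simpa using of_forall_notMem_eq_zero (a := fun _ : ι => (0 : Series)) ∅ (by simp)
  | insert k s hk ih =>
    simp only [Finset.sum_insert hk]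
    exact (h k (Finset.mem_insert_self k s)).add
      (ih fun j hj => h j (Finset.mem_insert_of_mem hj))

theorem congr (h : HasFormalSum a S) (hab : ∀ i, b i = a i) (hS : S' = S) : HasFormalSum b S' := by
  rw [hS, show b = a from funext hab]
  exact h

end HasFormalSum

/-- A family indexed by `ℤ` that starts at `k₀` and whose leading powers of `u` drop linearly is
summable. -/
theorem hasFormalSum_of_ordGE {a : ℤ → Series} (k₀ c : ℤ) (h0 : ∀ k < k₀, a k = 0)
    (h : ∀ k, OrdGE (a k) (k + c)) : HasFormalSum a (formalSum a) := by
  refine (exists_hasFormalSum fun n => (Set.finite_Icc k₀ (n - c)).subset fun k hk => ?_).2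
  constructor
  · by_contra hc
    refine hk ?_
    rw [h0 k (not_le.1 hc)]
    exact OrdGE.zero n
  · by_contra hc
    exact hk ((h k).mono (by omega))

/-! ### Shifted powers of linear polynomials in $u$ -/

/-- One recurrence covers both signs of $k$, as long as no integer translate of $x$ vanishes; the
later identities for shifted powers follow from it by induction in both directions. -/
theorem shiftedPow_succ {x : Scalar} (hx : ∀ i : ℤ, x + i ≠ 0) (k : ℤ) :
    shiftedPow x (k + 1) = shiftedPow x k * (x - k) := by
  match k with
  | .ofNat k =>
    rw [show (Int.ofNat k + 1 : ℤ) = Int.ofNat (k + 1) from rfl]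
    simp [shiftedPow, Finset.prod_range_succ]
  | .negSucc 0 =>
    have := hx 1
    push_cast at this
    rw [show (Int.negSucc 0 + 1 : ℤ) = Int.ofNat 0 from rfl]
    simp [shiftedPow, this]
  | .negSucc (k + 1) =>
    have := hx (k + 2 : ℕ)
    push_cast at this
    rw [show (Int.negSucc (k + 1) + 1 : ℤ) = Int.negSucc k from rfl]
    simp only [shiftedPow]
    rw [Finset.prod_range_succ _ (k + 1), mul_inv, Int.negSucc_eq]
    push_cast
    rw [mul_assoc, show x - -((k : Scalar) + 1 + 1) = x + (k + 2) by ring,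
      show x + ((k : Scalar) + 1 + 1) = x + (k + 2) by ring, inv_mul_cancel₀ this, mul_one]

theorem shiftedPow_zero (x : Scalar) : shiftedPow x 0 = 1 := by
  rw [show (0 : ℤ) = Int.ofNat 0 from rfl]
  simp [shiftedPow]

theorem sub_intCast_ne_zero {x : Scalar} (hx : ∀ i : ℤ, x + i ≠ 0) (k : ℤ) : x - k ≠ 0 := by
  simpa [sub_eq_add_neg] using hx (-k)

theorem shiftedPow_ne_zero {x : Scalar} (hx : ∀ i : ℤ, x + i ≠ 0) (k : ℤ) :
    shiftedPow x k ≠ 0 := by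
  induction k using Int.induction_on with
  | zero => rw [shiftedPow_zero]; exact one_ne_zero
  | succ k ih =>
    rw [shiftedPow_succ hx]
    exact mul_ne_zero ih (sub_intCast_ne_zero hx _)
  | pred k ih =>
    have := shiftedPow_succ hx (-k - 1)
    rw [sub_add_cancel] at this
    rw [this] at ih
    exact left_ne_zero_of_mul ih

/-- This splits the charge $m$ off the weights, producing the prefactors $(u|m)$ and $(-u|m)$ and
the shifted arguments $u\mp m$. -/
theorem shiftedPow_add {x : Scalar} (hx : ∀ i : ℤ, x + i ≠ 0) (m k : ℤ) :
    shiftedPow x (m + k) = shiftedPow x m * shiftedPow (x - m) k := by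
  have hx' : ∀ i : ℤ, x - m + i ≠ 0 := fun i => by
    have := hx (i - m)
    push_cast at this
    rwa [show x - m + i = x + (i - m) by ring]
  induction k using Int.induction_on with
  | zero => rw [add_zero, shiftedPow_zero, mul_one]
  | succ k ih =>
    rw [← add_assoc, shiftedPow_succ hx, ih, shiftedPow_succ hx']
    push_cast
    ring
  | pred k ih =>
    have h1 := shiftedPow_succ hx (m + (-k - 1))
    have h2 := shiftedPow_succ hx' (-k - 1)
    rw [show m + (-(k : ℤ) - 1) + 1 = m + -k by ring, ih] at h1
    rw [sub_add_cancel] at h2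
    rw [h2] at h1
    refine mul_right_cancel₀ (sub_intCast_ne_zero hx (m + (-k - 1))) (h1.symm.trans ?_)
    push_cast
    ring

/-- The linear polynomials in `u` that occur as arguments of shifted powers. -/
def IsLinear (x : Scalar) : Prop := ∃ (c : ℂ) (d : ℤ), c ≠ 0 ∧ x = HahnSeries.single (-1) c + (d : Scalar)

theorem isLinear_u : IsLinear u := ⟨1, 0, one_ne_zero, by simp [u]⟩

theorem intCast_eq_single (d : ℤ) : (d : Scalar) = HahnSeries.single 0 (d : ℂ) :=
  rfl

namespace IsLinear

theorem add_intCast {x : Scalar} (h : IsLinear x) (n : ℤ) : IsLinear (x + n) := by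
  obtain ⟨c, d, hc, rfl⟩ := h
  exact ⟨c, d + n, hc, by push_cast; ring⟩

theorem sub_intCast {x : Scalar} (h : IsLinear x) (n : ℤ) : IsLinear (x - n) := by
  simpa [sub_eq_add_neg] using h.add_intCast (-n)

theorem neg {x : Scalar} (h : IsLinear x) : IsLinear (-x) := by
  obtain ⟨c, d, hc, rfl⟩ := h
  exact ⟨-c, -d, neg_ne_zero.2 hc, by
    rw [HahnSeries.single_neg]; push_cast; ring⟩

theorem coeff_ne_zero {x : Scalar} (h : IsLinear x) : x.coeff (-1) ≠ 0 := by
  obtain ⟨c, d, hc, rfl⟩ := h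
  rw [HahnSeries.coeff_add, HahnSeries.coeff_single_same, intCast_eq_single,
    HahnSeries.coeff_single_of_ne (by norm_num), add_zero]
  exact hc

theorem ne_zero {x : Scalar} (h : IsLinear x) : x ≠ 0 := fun h0 => h.coeff_ne_zero (by simp [h0])

theorem add_intCast_ne_zero {x : Scalar} (h : IsLinear x) (i : ℤ) : x + i ≠ 0 :=
  (h.add_intCast i).ne_zero

theorem ordGE {x : Scalar} (h : IsLinear x) : OrdGE x (-1) := by
  obtain ⟨c, d, -, rfl⟩ := h
  refine (OrdGE.single _ _).add ?_
  rw [intCast_eq_single]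
  exact (OrdGE.single _ _).mono (by norm_num)

theorem ordGE_inv {x : Scalar} (h : IsLinear x) : OrdGE x⁻¹ 1 := by
  have h1 : x.order ≤ -1 := HahnSeries.order_le_of_coeff_ne_zero h.coeff_ne_zero
  have h2 := HahnSeries.order_mul h.ne_zero (inv_ne_zero h.ne_zero)
  rw [mul_inv_cancel₀ h.ne_zero, HahnSeries.order_one] at h2
  exact (OrdGE.order _).mono (by omega)

theorem ordGE_shiftedPow {x : Scalar} (h : IsLinear x) (k : ℤ) :
    OrdGE (shiftedPow x k) (-k) ∧ OrdGE (shiftedPow x k)⁻¹ k := by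
  have h1 : OrdGE (1 : Scalar) 0 := OrdGE.single 0 1
  have hs := shiftedPow_succ h.add_intCast_ne_zero
  induction k using Int.induction_on with
  | zero => rw [shiftedPow_zero, inv_one]; exact ⟨h1, h1⟩
  | succ k ih =>
    rw [hs, mul_inv]
    exact ⟨(ih.1.mul (h.sub_intCast _).ordGE).mono (by omega),
      ih.2.mul (h.sub_intCast _).ordGE_inv⟩
  | pred k ih =>
    have := hs (-k - 1)
    rw [sub_add_cancel] at this
    have h2 : shiftedPow x (-k - 1) = shiftedPow x (-k) * (x - (-k - 1 : ℤ))⁻¹ := by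
      rw [this, mul_assoc, mul_inv_cancel₀ (h.sub_intCast _).ne_zero, mul_one]
    rw [h2, mul_inv, inv_inv]
    exact ⟨(ih.1.mul (h.sub_intCast _).ordGE_inv).mono (by omega),
      (ih.2.mul (h.sub_intCast _).ordGE).mono (by omega)⟩

end IsLinear

/-! ### From basis elements to all of $z^mB$ -/

open Filter in
-- The truncation bound depends on $\lambda$; asking only for all large $P$ provides a common bound
-- for a finite linear combination.
theorem eventually_of_schur {Q : ℕ → BRing → Prop}
    (basis : ∀ μ : YoungDiagram, ∀ᶠ P in atTop, Q P (schur (parts μ)))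
    (add : ∀ P f g, Q P f → Q P g → Q P (f + g)) (smul : ∀ P (c : ℂ) f, Q P f → Q P (c • f))
    (f : BRing) : ∀ᶠ P in atTop, Q P f := by
  have hf : f ∈ Submodule.span ℂ (Set.range schurBasis) := by
    rw [schurBasis.span_eq]; exact Submodule.mem_top
  induction hf using Submodule.span_induction with
  | mem x hx =>
    obtain ⟨μ, rfl⟩ := hx
    rw [schurBasis_apply]
    exact basis μ
  | zero =>
    -- The value at zero is obtained as the zero multiple of a basis element.
    refine (basis ⊥).mono fun P hP => ?_
    have := smul P 0 _ hP
    rwa [zero_smul] at this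
  | add f g _ _ hf hg => exact (hf.and hg).mono fun P h => add P f g h.1 h.2
  | smul c f _ hf => exact hf.mono fun P h => smul P c f h

theorem boson_add (m : ℤ) (f g : BRing) : boson m (f + g) = boson m f + boson m g := by
  rw [boson, map_add, add_mul]; rfl

theorem boson_smul (m : ℤ) (c : ℂ) (f : BRing) : boson m (c • f) = c • boson m f := by
  simp only [boson, ← LaurentPolynomial.single_eq_C_mul_T, AddMonoidAlgebra.smul_single]

/-- `f ↦ z^m f` as a linear map. -/
noncomputable def bosonHom (m : ℤ) : BRing →ₗ[ℂ] FockRing where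
  toFun := boson m
  map_add' := boson_add m
  map_smul' := boson_smul m

theorem boson_sum {ι : Type} (m : ℤ) (s : Finset ι) (g : ι → BRing) :
    boson m (∑ i ∈ s, g i) = ∑ i ∈ s, boson m (g i) := map_sum (bosonHom m) g s

theorem psi_schur (k m : ℤ) (μ : YoungDiagram) :
    psi k (boson m (schur (parts μ))) = boson (m + 1) (schur ((k - m - 1) :: parts μ)) := by
  rw [boson, ← fockBasis_apply, psi, Module.Basis.constr_basis, boson]

theorem psiStar_schur (k m : ℤ) (μ : YoungDiagram) :
    psiStar k (boson m (schur (parts μ))) = boson (m - 1) (∑ᶠ t : ℕ,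
      if (parts μ).getD t 0 - t = k - m then (-1) ^ t * schur (removeRow (parts μ) t) else 0) := by
  rw [boson, ← fockBasis_apply, psiStar, Module.Basis.constr_basis]
  have hfin : (Function.support fun t : ℕ => if (parts μ).getD t 0 - t = k - m then
      (-1) ^ t * schur (removeRow (parts μ) t) else 0).Finite := by
    refine (Set.finite_le_nat ((parts μ).length + (m - k).toNat)).subset fun t ht => ?_
    by_contra hc
    simp only [Set.mem_ofPred_eq, not_le] at hc
    refine ht (if_neg ?_)
    rw [List.getD_eq_default _ _ (by omega)]
    omega
  refine Eq.trans ?_ ((bosonHom (m - 1)).toAddMonoidHom.map_finsum hfin).symm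
  refine finsum_congr fun t => ?_
  change _ = boson (m - 1) _
  dsimp only
  by_cases h : (parts μ).getD t 0 - t = k - m
  · rw [if_pos h, if_pos (by omega)]
    simp [boson]
  · rw [if_neg h, if_neg (by omega)]
    simp [boson]

theorem Dup_schur (p : ℤ) (μ : YoungDiagram) :
    Dup p (schur (parts μ)) = dupSum p (parts μ) := by
  rw [← schurBasis_apply, Dup, Module.Basis.constr_basis, dupSum]

theorem Dup_of_nonneg {p : ℤ} (hp : 0 ≤ p) (f : BRing) : Dup p f = 0 := by
  have : Dup p = 0 := schurBasis.ext fun μ => by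
    rw [schurBasis_apply, Dup_schur, dupSum_eq_zero hp, LinearMap.zero_apply]
  rw [this, LinearMap.zero_apply]

theorem Dlow_schur (p : ℤ) (μ : YoungDiagram) :
    Dlow p (schur (parts μ)) = if h : 0 ≤ p ∧ p ≤ (parts μ).length then
      Matrix.det (Matrix.of fun i j : Fin (parts μ).length =>
        hh ((Fin.succAbove (⟨p.toNat, by omega⟩ : Fin ((parts μ).length + 1)) j : ℕ) : ℤ)
          ((parts μ)[i] - (i : ℕ) - 1))
    else 0 := by
  rw [← schurBasis_apply, Dlow, Module.Basis.constr_basis]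

theorem Dlow_of_neg {p : ℤ} (hp : p < 0) (f : BRing) : Dlow p f = 0 := by
  have : Dlow p = 0 := schurBasis.ext fun μ => by
    rw [schurBasis_apply, Dlow_schur, dif_neg (by omega), LinearMap.zero_apply]
  rw [this, LinearMap.zero_apply]

theorem schur_cons_parts (n : ℤ) (μ : YoungDiagram) :
    schur (n :: parts μ) = ∑ p ∈ Finset.range ((parts μ).length + 1),
      (-1) ^ p * hh p n * Dlow p (schur (parts μ)) := by
  refine (schur_cons n (parts μ)).trans (Eq.trans (Finset.sum_congr rfl fun p _ => ?_)
    (Fin.sum_univ_eq_sum_range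
      (fun p : ℕ => (-1) ^ p * hh p n * Dlow p (schur (parts μ))) _))
  have hp : (p : ℕ) < (parts μ).length + 1 := p.2
  rw [Dlow_schur, dif_pos (by omega)]
  rfl

theorem exists_getD_lt (v : List ℤ) : ∃ M : ℕ, ∀ t : ℕ, v.getD t 0 < M := by
  induction v with
  | nil => exact ⟨1, fun t => by simp⟩
  | cons a v ih =>
    obtain ⟨M, hM⟩ := ih
    refine ⟨max M (a + 1).toNat, fun t => ?_⟩
    cases t with
    | zero => rw [List.getD_cons_zero]; omega
    | succ t =>
      have := hM t
      rw [List.getD_cons_succ]; omega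

open Filter in
/-- `ψ_k` in terms of the operators `D_p`. -/
theorem eventually_psi_eq (f : BRing) : ∀ᶠ P : ℕ in atTop, (∀ p : ℤ, P ≤ p → Dlow p f = 0) ∧
    ∀ k m, psi k (boson m f) = ∑ p ∈ Finset.range P,
      boson (m + 1) ((-1) ^ p * hh p (k - m - 1) * Dlow p f) := by
  refine eventually_of_schur (Q := fun P f => (∀ p : ℤ, P ≤ p → Dlow p f = 0) ∧
    ∀ k m, psi k (boson m f) = ∑ p ∈ Finset.range P,
      boson (m + 1) ((-1) ^ p * hh p (k - m - 1) * Dlow p f)) ?_ ?_ ?_ f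
  · intro μ
    refine (eventually_ge_atTop ((parts μ).length + 1)).mono fun P hP => ⟨fun p hp => ?_, ?_⟩
    · rw [Dlow_schur, dif_neg (by omega)]
    · intro k m
      have h0 : ∀ p ∈ Finset.range P, p ∉ Finset.range ((parts μ).length + 1) →
          (-1) ^ p * hh p (k - m - 1) * Dlow p (schur (parts μ)) = 0 := by
        intro p _ hp
        rw [Finset.mem_range] at hp
        rw [Dlow_schur, dif_neg (by omega), mul_zero]
      rw [psi_schur, ← boson_sum, schur_cons_parts, Finset.sum_subset (Finset.range_mono hP) h0]
  · intro P f g hf hg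
    refine ⟨fun p hp => by rw [map_add, hf.1 p hp, hg.1 p hp, add_zero], fun k m => ?_⟩
    simp only [boson_add, map_add, mul_add, Finset.sum_add_distrib, hf.2, hg.2]
  · intro P c f hf
    refine ⟨fun p hp => by rw [map_smul, hf.1 p hp, smul_zero], fun k m => ?_⟩
    simp only [boson_smul, map_smul, mul_smul_comm, ← Finset.smul_sum, hf.2]

open Filter in
/-- `ψ*_k` in terms of the operators `D^{(-p-1)}`. -/
theorem eventually_psiStar_eq (f : BRing) : ∀ᶠ P : ℕ in atTop,
    (∀ p : ℤ, P ≤ p → Dup (-p - 1) f = 0) ∧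
    ∀ k m, psiStar k (boson m f) = ∑ p ∈ Finset.range P,
      boson (m - 1) ((phi ^ (-(p : ℤ))) (signedEstar (p - (k - m))) * Dup (-p - 1) f) := by
  refine eventually_of_schur (Q := fun P f => (∀ p : ℤ, P ≤ p → Dup (-p - 1) f = 0) ∧
    ∀ k m, psiStar k (boson m f) = ∑ p ∈ Finset.range P,
      boson (m - 1) ((phi ^ (-(p : ℤ))) (signedEstar (p - (k - m))) * Dup (-p - 1) f)) ?_ ?_ ?_ f
  · intro μ
    -- For $p\ge M$ every coefficient $\varphi^{-p-1}h^*_{\lambda_t-t-p}$ has negative index.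
    obtain ⟨M, hM⟩ := exists_getD_lt (parts μ)
    refine (eventually_ge_atTop M).mono fun P hP => ⟨fun p hp => ?_, ?_⟩
    · rw [Dup_schur, dupSum]
      refine (finsum_congr fun t => ?_).trans finsum_zero
      have := hM t
      rw [hh_eq_zero (by omega)]
      simp
    · intro k m
      rw [psiStar_schur, finsum_removeRow (P := P) _ _ fun t => by have := hM t; omega, boson_sum]
      simp only [Dup_schur]
  · intro P f g hf hg
    refine ⟨fun p hp => by rw [map_add, hf.1 p hp, hg.1 p hp, add_zero], fun k m => ?_⟩
    simp only [boson_add, map_add, mul_add, Finset.sum_add_distrib, hf.2, hg.2]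
  · intro P c f hf
    refine ⟨fun p hp => by rw [map_smul, hf.1 p hp, smul_zero], fun k m => ?_⟩
    simp only [boson_smul, map_smul, mul_smul_comm, ← Finset.smul_sum, hf.2]

/-! ### Generating series of $h^{(p)}_n$ and of $\varphi^{-p}((-1)^te^*_t)$ -/

/-- Elements of `B` as constant series. -/
noncomputable def coeffHom : BRing →+* Series := (HahnSeries.C : FockRing →+* Series).comp C

theorem coeffHom_apply (f : BRing) : coeffHom f = const (C f) := rfl

theorem const_boson (m : ℤ) (f : BRing) : const (boson m f) = coeffHom f * const (T m) :=
  map_mul (HahnSeries.C : FockRing →+* Series) _ _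

theorem const_T_add_one (m : ℤ) : const (T (m + 1)) = z * const (T m) := by
  rw [add_comm, LaurentPolynomial.T_add]
  exact map_mul (HahnSeries.C : FockRing →+* Series) _ _

theorem const_T_sub_one (m : ℤ) : const (T (m - 1)) = zInv * const (T m) := by
  rw [sub_eq_neg_add, LaurentPolynomial.T_add]
  exact map_mul (HahnSeries.C : FockRing →+* Series) _ _

theorem const_sum {ι : Type} (s : Finset ι) (g : ι → FockRing) :
    const (∑ i ∈ s, g i) = ∑ i ∈ s, const (g i) :=
  map_sum (HahnSeries.C : FockRing →+* Series) g s

theorem ordGE_coeffHom (f : BRing) : OrdGE (coeffHom f) 0 := OrdGE.const _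

theorem zExt_boson (S : BRing →ₗ[ℂ] BRing) (m : ℤ) (f : BRing) :
    zExt S (boson m f) = boson m (S f) := zExt_apply S f m

theorem dU_const (F : FockRing) : dU (const F) = 0 := by
  rw [const, HahnSeries.C_apply, dU_single]; simp

/-- The Leibniz rule, needed only when one factor is a power of $u$; on coefficients it is
$1-n=k+(1-n-k)$. -/
theorem dU_zpow_mul (k : ℤ) (y : Series) :
    dU (scal (u ^ k) * y) = (k : Series) * (scal (u ^ (k - 1)) * y) + scal (u ^ k) * dU y := by
  ext1
  funext n
  rw [HahnSeries.coeff_add, ← zsmul_eq_mul, HahnSeries.coeff_smul, scal_u_zpow, scal_u_zpow]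
  change (1 - n) • (HahnSeries.single (-k) 1 * y).coeff (n - 1) = _
  rw [HahnSeries.coeff_single_mul, HahnSeries.coeff_single_mul, HahnSeries.coeff_single_mul,
    one_mul, one_mul, one_mul]
  change _ = _ + (1 - (n - -k)) • y.coeff ((n - -k) - 1)
  rw [show n - 1 - -k = n + k - 1 by ring, show n - -(k - 1) = n + k - 1 by ring,
    show n - -k - 1 = n + k - 1 by ring, ← add_smul]
  congr 1
  ring

theorem dU_zpow_mul_coeffHom (k : ℤ) (f : BRing) :
    dU (scal (u ^ k) * coeffHom f) = (k : Series) * (scal (u ^ (k - 1)) * coeffHom f) := by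
  rw [dU_zpow_mul, coeffHom_apply, dU_const, mul_zero, add_zero]

theorem coeffHom_hh_succ (p n : ℤ) : coeffHom (hh (p + 1) n) =
    coeffHom (hh p (n + 1)) + (n + p : Series) * coeffHom (hh p n) := by
  rw [hh_succ, map_add, map_mul, map_intCast, Int.cast_add]

/-- `φ^{-p}((-1)^t e*_t)` as a constant series. -/
noncomputable def eCoeff (p t : ℤ) : Series := coeffHom ((phi ^ (-p)) (signedEstar t))

theorem eCoeff_succ (p t : ℤ) :
    eCoeff (p + 1) t = eCoeff p t - (t - 1 : Series) * eCoeff p (t - 1) := by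
  rw [eCoeff, phi_neg_succ_signedEstar, map_sub, map_mul, map_intCast, Int.cast_sub, Int.cast_one]
  rfl

theorem eCoeff_neg (p : ℤ) {t : ℤ} (h : t < 0) : eCoeff p t = 0 := by
  rw [eCoeff, signedEstar_neg h, map_zero, map_zero]

theorem coeffHom_signedEstar (t : ℤ) :
    coeffHom (signedEstar t) = scal ((-1) ^ t) * coeffHom (estar t) := by
  rcases Int.even_or_odd t with h | h
  · rw [signedEstar, h.neg_one_zpow, h.neg_one_zpow, scal_one, one_smul, one_mul]
  · rw [signedEstar, h.neg_one_zpow, h.neg_one_zpow, scal_neg, scal_one, neg_smul, one_smul,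
      map_neg, neg_one_mul]

theorem eCoeff_zero (t : ℤ) : eCoeff 0 t = scal ((-1) ^ t) * coeffHom (estar t) := by
  rw [eCoeff, neg_zero, zpow_zero, AlgEquiv.one_apply, coeffHom_signedEstar]

theorem hh_zero_left (n : ℤ) : hh 0 n = hstar n := by
  rw [hh, zpow_zero, AlgEquiv.one_apply, add_zero]

theorem hasFormalSum_H : HasFormalSum (HTerm u⁻¹) (H u⁻¹) := by
  refine hasFormalSum_of_ordGE 0 0 (fun k hk => ?_) fun k => ?_
  · rw [HTerm, hstar_neg hk, ← coeffHom_apply, map_zero, mul_zero]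
  · have : OrdGE (u⁻¹ ^ k) k := by
      rw [inv_zpow', u_zpow, neg_neg]; exact OrdGE.single _ _
    exact this.scal.mul (OrdGE.const _)

theorem hasFormalSum_E : HasFormalSum (ETerm (-u⁻¹)) (E (-u⁻¹)) := by
  refine hasFormalSum_of_ordGE 0 0 (fun k hk => ?_) fun k => ?_
  · rw [ETerm, estar_neg hk, ← coeffHom_apply, map_zero, mul_zero]
  · have : OrdGE ((-u⁻¹) ^ k) k := by
      rw [neg_eq_neg_one_mul, mul_zpow, inv_zpow', u_zpow, neg_neg]
      rcases Int.even_or_odd k with h | h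
      · rw [h.neg_one_zpow, one_mul]; exact OrdGE.single _ _
      · rw [h.neg_one_zpow, neg_one_mul, ← HahnSeries.single_neg]; exact OrdGE.single _ _
    exact this.scal.mul (OrdGE.const _)

theorem hasFormalSum_HTilde {x : Scalar} (hx : IsLinear x) :
    HasFormalSum (HTildeTerm x) (HTilde x) := by
  refine hasFormalSum_of_ordGE 0 0 (fun k hk => ?_) fun k => ?_
  · rw [HTildeTerm, hstar_neg hk, ← coeffHom_apply, map_zero, mul_zero]
  · exact (hx.ordGE_shiftedPow k).2.scal.mul (OrdGE.const _)

theorem hasFormalSum_ETilde {x : Scalar} (hx : IsLinear x) :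
    HasFormalSum (ETildeTerm x) (ETilde x) := by
  refine hasFormalSum_of_ordGE 0 0 (fun k hk => ?_) fun k => ?_
  · rw [ETildeTerm, estar_neg hk, ← coeffHom_apply, map_zero, mul_zero]
  · exact (hx.ordGE_shiftedPow k).2.scal.mul (OrdGE.const _)

theorem scal_zpow_add (a b : ℤ) : scal (u ^ (a + b)) = scal (u ^ a) * scal (u ^ b) := by
  rw [zpow_add₀ u_ne_zero, scal_mul]

/-- If $G_p$ is the sum, the recursion for $h^{(p+1)}_n$ reads $G_{p+1}=uG_p+pG_p-u\,\partial_uG_p$.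
The factor $u^p$ in $G_p$ cancels the term $pG_p$ and leaves one more factor $u(1-\partial_u)$. -/
theorem hasFormalSum_hh (p : ℕ) :
    HasFormalSum (fun n : ℤ => scal (u ^ (-n)) * coeffHom (hh p n))
      (scal (u ^ (p : ℤ)) * ((1 - dU : Module.End ℂ Series) ^ p) (H u⁻¹)) := by
  induction p with
  | zero =>
    refine hasFormalSum_H.congr (fun n => ?_) (by simp [scal_one])
    rw [HTerm, inv_zpow', Nat.cast_zero, hh_zero_left, coeffHom_apply]
  | succ p ih =>
    refine ((((ih.comp_equiv (Equiv.addRight 1)).mul_left (scal (u ^ (1 : ℤ)))).add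
      (ih.mul_left (p : Series))).sub (ih.dU.mul_left (scal (u ^ (1 : ℤ))))).congr
      (fun n => ?_) ?_
    · rw [Nat.cast_succ, coeffHom_hh_succ, dU_zpow_mul_coeffHom, Equiv.coe_addRight,
        show -n = 1 + -(n + 1) by ring, scal_zpow_add, show 1 + -(n + 1) - 1 = -(n + 1) by ring]
      push_cast
      ring
    · rw [dU_zpow_mul, pow_succ', Module.End.mul_apply, LinearMap.sub_apply, Module.End.one_apply,
        Nat.cast_succ, show (p : ℤ) = p - 1 + 1 by ring, scal_zpow_add _ 1, scal_zpow_add _ 1]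
      push_cast
      simp only [sub_add_cancel]
      ring

/-- The term $-(t-1)u^{-t}$ of the recursion is $\partial_u u^{-(t-1)}$, so each step applies
$\partial_u+1$. -/
theorem hasFormalSum_eCoeff (p : ℕ) :
    HasFormalSum (fun t : ℤ => scal (u ^ (-t)) * eCoeff p t)
      (((dU + 1 : Module.End ℂ Series) ^ p) (E (-u⁻¹))) := by
  induction p with
  | zero =>
    refine hasFormalSum_E.congr (fun t => ?_) (by simp)
    rw [ETerm, neg_eq_neg_one_mul u⁻¹, mul_zpow, inv_zpow', scal_mul, Nat.cast_zero, eCoeff_zero,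
      coeffHom_apply]
    ring
  | succ p ih =>
    refine ((ih.dU.comp_equiv (Equiv.subRight 1)).add ih).congr (fun t => ?_) ?_
    · rw [Nat.cast_succ, eCoeff_succ, Equiv.subRight_apply, eCoeff, eCoeff, dU_zpow_mul_coeffHom,
        show -(t - 1) - 1 = -t by ring]
      push_cast
      ring
    · rw [pow_succ', Module.End.mul_apply, LinearMap.add_apply, Module.End.one_apply]

/-- Put $y_n=h^{(p)}_n/(x|n-1)$. Writing $n+p=(x+p+1)-(x-n+1)$ turns the recursion into
$(x+p+1)h^{(p)}_n/(x|n)+y_{n+1}-y_n$. The difference sums to zero, and $x+p+1$ is the quotient of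
$(x|-p)$ by $(x|-p-1)$. -/
theorem hasFormalSum_hh_shiftedPow {x : Scalar} (hx : IsLinear x) (p : ℕ) :
    HasFormalSum (fun n : ℤ => scal (shiftedPow x n)⁻¹ * coeffHom (hh p n))
      (HTilde x * scal (shiftedPow x (-p))⁻¹) := by
  have hs := shiftedPow_succ hx.add_intCast_ne_zero
  induction p with
  | zero =>
    refine (hasFormalSum_HTilde hx).congr (fun n => ?_) ?_
    · rw [Nat.cast_zero, hh_zero_left, HTildeTerm, coeffHom_apply]
    · rw [Nat.cast_zero, neg_zero, shiftedPow_zero, inv_one, scal_one, mul_one]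
  | succ p ih =>
    have hy := hasFormalSum_of_ordGE
      (a := fun n : ℤ => scal (shiftedPow x (n - 1))⁻¹ * coeffHom (hh p n)) (-p) (-1)
      (fun n hn => by rw [hh_eq_zero (by omega), map_zero, mul_zero])
      (fun n => ((hx.ordGE_shiftedPow (n - 1)).2.scal.mul (ordGE_coeffHom _)).mono (by omega))
    refine ((ih.mul_left (scal (x + p + 1))).add
      ((hy.comp_equiv (Equiv.addRight 1)).sub hy)).congr (fun n => ?_) ?_
    · have h1 := hs (n - 1)
      rw [sub_add_cancel] at h1
      have h2 : (shiftedPow x (n - 1))⁻¹ = (shiftedPow x n)⁻¹ * (x - n + 1) := by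
        rw [h1, mul_inv, mul_assoc]
        push_cast
        rw [show x - (n - 1) = x - (n : Scalar) + 1 by ring, inv_mul_cancel₀, mul_one]
        have := hx.add_intCast_ne_zero (-n + 1)
        push_cast at this
        rwa [sub_eq_add_neg, add_assoc]
      rw [Nat.cast_succ, coeffHom_hh_succ, Equiv.coe_addRight, add_sub_cancel_right, h2, scal_mul,
        show x + p + 1 = (x - n + 1) + ((n + p : ℤ) : Scalar) by push_cast; ring, scal_add _ (_ : ℤ),
        scal_intCast]
      push_cast
      ring
    · have h1 := hs (-p - 1)
      rw [sub_add_cancel] at h1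
      rw [h1, sub_self, add_zero, Nat.cast_succ, neg_add', mul_inv, scal_mul]
      have h2 : scal (x - ((-p - 1 : ℤ) : Scalar))⁻¹ * scal (x + p + 1) = 1 := by
        rw [← scal_mul, ← scal_one]
        congr 1
        push_cast
        rw [show x - (-(p : Scalar) - 1) = x + p + 1 by ring]
        have := hx.add_intCast_ne_zero (p + 1)
        push_cast at this
        rw [inv_mul_cancel₀ (by rwa [add_assoc])]
      linear_combination (-(HTilde x * scal (shiftedPow x (-p - 1))⁻¹)) * h2

/-- The product $(-1)^t(-x|1-t)(x|t)$ does not depend on $t$, and it equals $-x$ at $t=0$. This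
converts the weights of $\tilde\Psi^*$ into those of $\tilde E$. -/
theorem shiftedPow_neg_eq {x : Scalar} (hx : IsLinear x) (t : ℤ) :
    shiftedPow (-x) (1 - t) = -x * ((-1) ^ t * (shiftedPow x t)⁻¹) := by
  have hs := shiftedPow_succ hx.add_intCast_ne_zero
  have hs' := shiftedPow_succ hx.neg.add_intCast_ne_zero
  have h1 : (-1 : Scalar) ≠ 0 := neg_ne_zero.2 one_ne_zero
  have step : ∀ t, shiftedPow (-x) (1 - t) * shiftedPow x t * (-1) ^ t =
      shiftedPow (-x) (1 - (t + 1)) * shiftedPow x (t + 1) * (-1) ^ (t + 1) := fun t => by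
    rw [hs, zpow_add_one₀ h1, show 1 - t = 1 - (t + 1) + 1 by ring, hs']
    push_cast
    ring
  have key : ∀ t : ℤ, shiftedPow (-x) (1 - t) * shiftedPow x t * (-1) ^ t = -x := fun t => by
    induction t using Int.induction_on with
    | zero =>
      have := hs' 0
      rw [zero_add, shiftedPow_zero] at this
      rw [sub_zero, this, shiftedPow_zero]
      simp
    | succ t ih => rw [← step, ih]
    | pred t ih => rw [step, sub_add_cancel, ih]
  have h2 := shiftedPow_ne_zero hx.add_intCast_ne_zero t
  have h3 : ((-1 : Scalar) ^ t) * (-1) ^ t = 1 := by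
    rw [← mul_zpow]; simp
  calc shiftedPow (-x) (1 - t) = shiftedPow (-x) (1 - t) * (shiftedPow x t * (shiftedPow x t)⁻¹) *
        ((-1) ^ t * (-1) ^ t) := by rw [h3, mul_inv_cancel₀ h2]; ring
    _ = (shiftedPow (-x) (1 - t) * shiftedPow x t * (-1) ^ t) *
        ((-1) ^ t * (shiftedPow x t)⁻¹) := by ring
    _ = _ := by rw [key]

/-- The telescoping argument again, now with $t\,(-x|p-t+1)\,\varphi^{-p}((-1)^te^*_t)$ as the
telescoping term; each step contributes the factor $-x-p-1$. The argument $x-1$ on the right arises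
because the case $p=0$ gives $-x=-1/(x-1|-1)$. -/
theorem hasFormalSum_eCoeff_shiftedPow {x : Scalar} (hx : IsLinear x) (p : ℕ) :
    HasFormalSum (fun t : ℤ => scal (shiftedPow (-x) (p - t + 1)) * eCoeff p t)
      (ETilde x * scal ((-1) ^ (-(p : ℤ) - 1) / shiftedPow (x - 1) (-p - 1))) := by
  have hx1 : IsLinear (x - 1) := by simpa using hx.sub_intCast 1
  have hs := shiftedPow_succ hx1.add_intCast_ne_zero
  have hs' := shiftedPow_succ hx.neg.add_intCast_ne_zero
  induction p with
  | zero =>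
    refine ((hasFormalSum_ETilde hx).mul_left (scal (-x))).congr (fun t => ?_) ?_
    · rw [Nat.cast_zero, zero_sub, neg_add_eq_sub, shiftedPow_neg_eq hx, eCoeff_zero, ETildeTerm,
        ← coeffHom_apply, scal_mul, scal_mul]
      have h3 : scal ((-1) ^ t) * scal ((-1) ^ t) = 1 := by
        rw [← scal_mul, ← mul_zpow]; simp [scal_one]
      linear_combination (scal (-x) * scal (shiftedPow x t)⁻¹ * coeffHom (estar t)) * h3
    · have h1 := hs (-1)
      rw [neg_add_cancel, shiftedPow_zero] at h1
      rw [Nat.cast_zero, neg_zero, zero_sub, mul_comm]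
      congr 2
      rw [div_eq_iff (shiftedPow_ne_zero hx1.add_intCast_ne_zero _)]
      push_cast at h1
      rw [zpow_neg_one, inv_neg_one]
      linear_combination -h1
  | succ p ih =>
    have hz := hasFormalSum_of_ordGE (a := fun t : ℤ =>
        (t : Series) * (scal (shiftedPow (-x) (p - t + 1)) * eCoeff p t)) 0 (-p - 1)
      (fun t ht => by rw [eCoeff_neg _ ht, mul_zero, mul_zero])
      (fun t => by
        have h := ((hx.neg.ordGE_shiftedPow (p - t + 1)).1.scal.mul
          (ordGE_coeffHom ((phi ^ (-(p : ℤ))) (signedEstar t))))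
        intro j hj
        rw [← zsmul_eq_mul, HahnSeries.coeff_smul, eCoeff, h j (by omega), smul_zero])
    refine ((ih.mul_left (scal (-x - p - 1))).add
      (hz.sub (hz.comp_equiv (Equiv.subRight 1)))).congr (fun t => ?_) ?_
    · rw [Nat.cast_succ, eCoeff_succ, Equiv.subRight_apply,
        show (p : ℤ) - (t - 1) + 1 = p - t + 1 + 1 by ring,
        show (p : ℤ) + 1 - t + 1 = p - t + 1 + 1 by ring, hs', scal_mul,
        show -x - p - 1 = -x - ((p - t + 1 : ℤ) : Scalar) - ((t : ℤ) : Scalar) by push_cast; ring,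
        scal_sub _ (t : Scalar), scal_intCast]
      push_cast
      ring
    · have h1 := hs (-p - 1 - 1)
      rw [sub_add_cancel] at h1
      have h2 : x - 1 - ((-p - 1 - 1 : ℤ) : Scalar) = x + p + 1 := by push_cast; ring
      have h3 : x + p + 1 ≠ 0 := h2 ▸ (hx1.sub_intCast _).ne_zero
      rw [h1, h2, sub_self, add_zero, Nat.cast_succ, neg_add', mul_left_comm, ← scal_mul]
      congr 2
      have h4 := zpow_add_one₀ (neg_ne_zero.2 one_ne_zero : (-1 : Scalar) ≠ 0) (-(p : ℤ) - 1 - 1)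
      rw [sub_add_cancel] at h4
      rw [h4]
      have h5 := shiftedPow_ne_zero hx1.add_intCast_ne_zero (-p - 1 - 1)
      field_simp
      ring

/-! ### Assembling the vertex operators -/

/-- A generating series of the fermions `ψ_k`, from the generating series of the `h^{(p)}_n`. -/
theorem hasFormalSum_psi {w : ℤ → Scalar} {X : ℕ → Series}
    (hX : ∀ p : ℕ, HasFormalSum (fun n => scal (w n) * coeffHom (hh p n)) (X p)) (c : Scalar)
    {f : BRing} {P : ℕ} (m : ℤ) (hP : ∀ k m, psi k (boson m f) = ∑ p ∈ Finset.range P,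
      boson (m + 1) ((-1) ^ p * hh p (k - m - 1) * Dlow p f)) :
    HasFormalSum (fun k => scal (c * w (k - m - 1)) * const (psi k (boson m f)))
      (∑ p ∈ Finset.range P,
        X p * ((-1) ^ p * (z * scal c * const (boson m (Dlow p f))))) := by
  refine (HasFormalSum.sum (Finset.range P) fun p _ => ((hX p).comp_equiv
    (Equiv.subRight (m + 1))).mul_right
      ((-1) ^ p * (z * scal c * const (boson m (Dlow p f))))).congr (fun k => ?_) rfl
  rw [hP, const_sum, Finset.mul_sum]
  refine Finset.sum_congr rfl fun p _ => ?_
  rw [const_boson, const_boson, const_T_add_one, map_mul, map_mul, map_pow, map_neg, map_one,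
    Equiv.subRight_apply, scal_mul, sub_sub]
  ring

/-- A generating series of the fermions `ψ*_k`, from the generating series of the
`φ^{-p}((-1)^t e*_t)`. -/
theorem hasFormalSum_psiStar {w : ℤ → Scalar} {X : ℕ → Series}
    (hX : ∀ p : ℕ, HasFormalSum (fun t => scal (w (p - t)) * eCoeff p t) (X p)) (c : Scalar)
    {f : BRing} {P : ℕ} (m : ℤ) (hP : ∀ k m, psiStar k (boson m f) = ∑ p ∈ Finset.range P,
      boson (m - 1) ((phi ^ (-(p : ℤ))) (signedEstar (p - (k - m))) * Dup (-p - 1) f)) :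
    HasFormalSum (fun k => scal (c * w (k - m)) * const (psiStar k (boson m f)))
      (∑ p ∈ Finset.range P, X p * (zInv * scal c * const (boson m (Dup (-p - 1) f)))) := by
  refine (HasFormalSum.sum (Finset.range P) fun p _ => ((hX p).comp_equiv
    (Equiv.subLeft (p + m : ℤ))).mul_right
      (zInv * scal c * const (boson m (Dup (-p - 1) f)))).congr (fun k => ?_) rfl
  rw [hP, const_sum, Finset.mul_sum]
  refine Finset.sum_congr rfl fun p _ => ?_
  rw [const_boson, const_boson, const_T_sub_one, map_mul, Equiv.subLeft_apply, scal_mul, eCoeff,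
    show (p : ℤ) - (p + m - k) = k - m by ring, show (p : ℤ) + m - k = p - (k - m) by ring]
  ring

theorem hasFormalSum_HDTerm {f : BRing} {P : ℕ} (m : ℤ) (hP : ∀ p : ℤ, P ≤ p → Dlow p f = 0) :
    HasFormalSum (HDTerm (boson m f)) (∑ p ∈ Finset.range P, HDTerm (boson m f) p) := by
  refine HasFormalSum.of_forall_notMem_eq_zero _ fun p hp => ?_
  rw [Finset.mem_range] at hp
  rw [HDTerm, zExt_boson, hP p (by omega), const_boson, map_zero, zero_mul, mul_zero, zero_mul]

theorem hasFormalSum_EDTerm {f : BRing} {P : ℕ} (m : ℤ)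
    (hP : ∀ p : ℤ, P ≤ p → Dup (-p - 1) f = 0) :
    HasFormalSum (EDTerm (boson m f)) (∑ p ∈ Finset.range P, EDTerm (boson m f) p) := by
  refine HasFormalSum.of_forall_notMem_eq_zero _ fun p hp => ?_
  rw [Finset.mem_range] at hp
  rw [EDTerm, zExt_boson, hP p (by omega), const_boson, map_zero, zero_mul, mul_zero, zero_mul]

theorem hasFormalSum_DETildeTerm {f : BRing} {P : ℕ} (x : Scalar) (m : ℤ)
    (hP : ∀ p : ℤ, P ≤ p → Dlow p f = 0) :
    HasFormalSum (DETildeTerm x (boson m f))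
      (∑ p ∈ Finset.range P, DETildeTerm x (boson m f) p) := by
  have := HasFormalSum.of_forall_notMem_eq_zero (a := DETildeTerm x (boson m f))
    ((Finset.range P).map Nat.castEmbedding) fun p hp => by
      have h0 : Dlow p f = 0 := by
        rcases lt_or_ge p 0 with h | h
        · exact Dlow_of_neg h f
        · refine hP p ?_
          by_contra hc
          exact hp (Finset.mem_map.2 ⟨p.toNat, Finset.mem_range.2 (by omega),
            Int.toNat_of_nonneg h⟩)
      rw [DETildeTerm, zExt_boson, h0, const_boson, map_zero, zero_mul, mul_zero]
  rwa [Finset.sum_map] at this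

theorem hasFormalSum_DHTildeTerm {f : BRing} {P : ℕ} (x : Scalar) (m : ℤ)
    (hP : ∀ p : ℤ, P ≤ p → Dup (-p - 1) f = 0) :
    HasFormalSum (DHTildeTerm x (boson m f))
      (∑ p ∈ Finset.range P, DHTildeTerm x (boson m f) (-p - 1)) := by
  have := HasFormalSum.of_forall_notMem_eq_zero (a := DHTildeTerm x (boson m f))
    -- Only negative upper indices survive, so the series over all integers is a finite sum over
    -- $q=-p-1$.
    ((Finset.range P).map ⟨fun p : ℕ => -(p : ℤ) - 1, fun p q h => by simpa using h⟩)
    fun q hq => by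
      have h0 : Dup q f = 0 := by
        rcases lt_or_ge q 0 with h | h
        · rw [show q = -(-q - 1) - 1 by ring]
          refine hP _ ?_
          by_contra hc
          refine hq (Finset.mem_map.2 ⟨(-q - 1).toNat, Finset.mem_range.2 (by omega), ?_⟩)
          change -(((-q - 1).toNat : ℕ) : ℤ) - 1 = q
          omega
        · exact Dup_of_nonneg h f
      rw [DHTildeTerm, zExt_boson, h0, const_boson, map_zero, zero_mul, mul_zero]
  rwa [Finset.sum_map] at this

theorem neg_one_pow_mul_pow_one_sub (p : ℕ) (S : Series) :
    (-1) ^ p * ((1 - dU : Module.End ℂ Series) ^ p) S = ((dU - 1 : Module.End ℂ Series) ^ p) S := by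
  rw [← neg_sub 1 (dU : Module.End ℂ Series), neg_pow (1 - dU : Module.End ℂ Series)]
  rcases neg_one_pow_eq_or (Module.End ℂ Series) p with h | h <;>
  rcases Nat.even_or_odd p with h' | h' <;>
  simp [h'.neg_one_pow]

theorem vertexOperator_psi (m : ℤ) (f : BRing) :
    FormallySummable (PsiTerm u⁻¹ (boson m f)) ∧ FormallySummable (PsiTildeTerm u (boson m f)) ∧
    FormallySummable (DETildeTerm (u - m) (boson m f)) ∧
    FormallySummable (HDTerm (boson m f)) ∧
    Psi u⁻¹ (boson m f) = z * scal (u ^ (-m - 1)) * formalSum (HDTerm (boson m f)) ∧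
    PsiTilde u (boson m f) =
      z * scal (shiftedPow u m)⁻¹ * HTilde (u - m) * DETilde (u - m) (boson m f) := by
  obtain ⟨P, hD, hP⟩ := (eventually_psi_eq f).exists
  have hE := hasFormalSum_DETildeTerm (u - m) m hD
  have hH := hasFormalSum_HDTerm m hD
  have h1 := hasFormalSum_psi hasFormalSum_hh (u ^ (-m - 1)) m hP
  have h2 := hasFormalSum_psi (hasFormalSum_hh_shiftedPow (isLinear_u.sub_intCast m))
    (shiftedPow u m)⁻¹ m hP
  -- The index of $h^{(p)}$ in $\psi_k$ is $k-m-1$, so the weight is split into a factor depending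
  -- only on $m$ and a weight in $k-m-1$.
  have e1 : PsiTerm u⁻¹ (boson m f) = _ := funext fun k => by
    rw [PsiTerm, inv_zpow', show -k = -m - 1 + -(k - m - 1) by ring, zpow_add₀ u_ne_zero]
  have e2 : PsiTildeTerm u (boson m f) = _ := funext fun k => by
    rw [PsiTildeTerm, show k - 1 = m + (k - m - 1) by ring,
      shiftedPow_add isLinear_u.add_intCast_ne_zero, mul_inv]
  rw [← e1] at h1
  rw [← e2] at h2
  refine ⟨h1.formallySummable, h2.formallySummable, hE.formallySummable, hH.formallySummable,
    ?_, ?_⟩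
  · rw [Psi, h1.formalSum_eq, hH.formalSum_eq, Finset.mul_sum]
    refine Finset.sum_congr rfl fun p _ => ?_
    rw [HDTerm, zExt_boson, ← neg_one_pow_mul_pow_one_sub, zpow_natCast]
    ring
  · rw [PsiTilde, h2.formalSum_eq, DETilde, hE.formalSum_eq, Finset.mul_sum]
    refine Finset.sum_congr rfl fun p _ => ?_
    rw [DETildeTerm, zExt_boson, div_eq_mul_inv, scal_mul, zpow_natCast]
    have : scal ((-1) ^ p) = (-1) ^ p := by
      have := map_pow scalHom (-1) p
      rwa [map_neg, map_one] at this
    rw [this]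
    ring

theorem vertexOperator_psiStar (m : ℤ) (f : BRing) :
    FormallySummable (PsiStarTerm u⁻¹ (boson m f)) ∧
    FormallySummable (PsiStarTildeTerm u (boson m f)) ∧
    FormallySummable (DHTildeTerm (u + m - 1) (boson m f)) ∧
    FormallySummable (EDTerm (boson m f)) ∧
    PsiStar u⁻¹ (boson m f) = zInv * scal (u ^ m) * formalSum (EDTerm (boson m f)) ∧
    PsiStarTilde u (boson m f) =
      zInv * scal (shiftedPow (-u) m) * ETilde (u + m) * DHTilde (u + m - 1) (boson m f) := by
  obtain ⟨P, hD, hP⟩ := (eventually_psiStar_eq f).exists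
  have hH := hasFormalSum_DHTildeTerm (u + m - 1) m hD
  have hE := hasFormalSum_EDTerm m hD
  have hX : ∀ p : ℕ, HasFormalSum (fun t : ℤ => scal (u ^ (p - t)) * eCoeff p t)
      (scal (u ^ (p : ℤ)) * ((dU + 1 : Module.End ℂ Series) ^ p) (E (-u⁻¹))) := fun p =>
    ((hasFormalSum_eCoeff p).mul_left (scal (u ^ (p : ℤ)))).congr
      (fun t => by rw [sub_eq_add_neg, scal_zpow_add, mul_assoc]) rfl
  have h1 := hasFormalSum_psiStar (w := fun b => u ^ b) hX (u ^ m) m hP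
  -- The weight is evaluated at $k-m=p-t$. With $x=u+m$ the argument $x-1$ of the summation lemma
  -- becomes the $u+m-1$ of $D\tilde H$.
  have h2 := hasFormalSum_psiStar (w := fun b => shiftedPow (-(u + m)) (b + 1))
    (hasFormalSum_eCoeff_shiftedPow (isLinear_u.add_intCast m)) (shiftedPow (-u) m) m hP
  have e1 : PsiStarTerm u⁻¹ (boson m f) = _ := funext fun k => by
    rw [PsiStarTerm, inv_zpow', neg_neg, show k = m + (k - m) by ring, zpow_add₀ u_ne_zero,
      show m + (k - m) = k by ring]
  have e2 : PsiStarTildeTerm u (boson m f) = _ := funext fun k => by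
    rw [PsiStarTildeTerm, show k + 1 = m + (k - m + 1) by ring,
      shiftedPow_add isLinear_u.neg.add_intCast_ne_zero, ← neg_add']
  rw [← e1] at h1
  rw [← e2] at h2
  refine ⟨h1.formallySummable, h2.formallySummable, hH.formallySummable, hE.formallySummable,
    ?_, ?_⟩
  · rw [PsiStar, h1.formalSum_eq, hE.formalSum_eq, Finset.mul_sum]
    refine Finset.sum_congr rfl fun p _ => ?_
    rw [EDTerm, zExt_boson, zpow_natCast]
    ring
  · rw [PsiStarTilde, h2.formalSum_eq, DHTilde, hH.formalSum_eq, Finset.mul_sum]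
    refine Finset.sum_congr rfl fun p _ => ?_
    rw [DHTildeTerm, zExt_boson]
    ring

end ShiftedSchur

open ShiftedSchur in
theorem mainTheorem6 (m : ℤ) (f : BRing) :
    -- all formal sums below make sense
    (FormallySummable (PsiTerm u⁻¹ (boson m f)) ∧
      FormallySummable (PsiStarTerm u⁻¹ (boson m f)) ∧
      FormallySummable (PsiTildeTerm u (boson m f)) ∧
      FormallySummable (PsiStarTildeTerm u (boson m f)) ∧
      FormallySummable (HTerm u⁻¹) ∧
      FormallySummable (ETerm (-u⁻¹)) ∧
      FormallySummable (HTildeTerm (u - m)) ∧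
      FormallySummable (ETildeTerm (u + m)) ∧
      FormallySummable (DETildeTerm (u - m) (boson m f)) ∧
      FormallySummable (DHTildeTerm (u + m - 1) (boson m f)) ∧
      FormallySummable (HDTerm (boson m f)) ∧
      FormallySummable (EDTerm (boson m f))) ∧
    Psi u⁻¹ (boson m f) = z * scal (u ^ (-m - 1)) * formalSum (HDTerm (boson m f)) ∧
    PsiStar u⁻¹ (boson m f) = zInv * scal (u ^ m) * formalSum (EDTerm (boson m f)) ∧
    PsiTilde u (boson m f) =
      z * scal (shiftedPow u m)⁻¹ * HTilde (u - m) * DETilde (u - m) (boson m f) ∧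
    PsiStarTilde u (boson m f) =
      zInv * scal (shiftedPow (-u) m) * ETilde (u + m) * DHTilde (u + m - 1) (boson m f) := by
  obtain ⟨h1, h2, h3, h4, h5, h6⟩ := vertexOperator_psi m f
  obtain ⟨g1, g2, g3, g4, g5, g6⟩ := vertexOperator_psiStar m f
  exact ⟨⟨h1, g1, h2, g2, hasFormalSum_H.formallySummable, hasFormalSum_E.formallySummable,
    (hasFormalSum_HTilde (isLinear_u.sub_intCast m)).formallySummable,
    (hasFormalSum_ETilde (isLinear_u.add_intCast m)).formallySummable,
    h3, g3, h4, g4⟩, h5, g5, h6, g6⟩
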